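/- Let $K$ be a finite field extension of $\mathbb{Q}_2$. Write $\mathcal{O}_K$ for its ring of integers, $\mathfrak{p}_K$ for the maximal ideal of $\mathcal{O}_K$, $q = \#(\mathcal{O}_K/\mathfrak{p}_K)$ for the size of the residue field, $e_K = e(K/\mathbb{Q}_2)$ for the absolute ramification index, and $v_K$ for the valuation normalised so that $v_K(\mathfrak{p}_K) = 1$. Let $\Sigma^{V_4}$ be the set of $K$-isomorphism classes of totally ramified quartic field extensions $L/K$ such that $\operatorname{Gal}(\widetilde{L}/K) \cong V_4 = C_2 \times C_2$, where $\widetilde{L}$ is the normal closure of $L$ over $K$. For a set $S$ of isomorphism classes of finite extensions of $K$, define its mass $$\widetilde{m}(S) = \sum_{L \in S} \frac{(\#\operatorname{Aut}(L/K))^{-1}}{q^{v_K(d_{L/K})}},$$ where $d_{L/K}$ is the discriminant ideal of $L/K$. Then $\Sigma^{V_4}$ is finite and $$ \widetilde{m}(\Sigma^{V_4}) = \frac{q-1}{6}\cdot \Big(q^{-4e_K-3}\cdot \frac{q^{4e_K} - 1}{q^4 - 1} \cdot (3q^3 + q^2 + q + 3) - 3 q^{-3e_K - 3}\cdot \frac{q^{3e_K}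 - 1}{q^3 - 1} \cdot (q^2 + 1)\Big). $$ -/

import Mathlib

open IntermediateField

noncomputable section

namespace TwoAdic

/-! ### Rings of integers of `2`-adic fields -/

section Integers

variable (F : Type*) [Field F] [Algebra ℤ_[2] F]

/-- The ring of integers `𝒪_F` of an algebraic extension `F` of `ℚ₂`: the integral closure of
`ℤ₂` in `F`. -/
abbrev Integers : Subalgebra ℤ_[2] F := integralClosure ℤ_[2] F

variable [Algebra ℚ_[2] F] [IsScalarTower ℤ_[2] ℚ_[2] F] [Algebra.IsAlgebraic ℚ_[2] F]

/-- The integral elements are those of spectral norm at most `1`. -/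
theorem mem_integers_iff (x : F) : x ∈ Integers F ↔ spectralNorm ℚ_[2] F x ≤ 1 := by
  have hx : IsIntegral ℚ_[2] x := Algebra.IsIntegral.isIntegral x
  rw [mem_integralClosure_iff, spectralNorm, spectralValue_le_one_iff (minpoly.monic hx)]
  constructor
  · intro h n
    rw [minpoly.isIntegrallyClosed_eq_field_fractions' ℚ_[2] h, Polynomial.coeff_map]
    exact PadicInt.norm_le_one _
  · intro h
    have hl : minpoly ℚ_[2] x ∈ Polynomial.lifts (algebraMap ℤ_[2] ℚ_[2]) := by
      rw [Polynomial.lifts_iff_coeff_lifts]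
      intro n
      exact ⟨⟨_, h n⟩, rfl⟩
    obtain ⟨g, hg, -, hgm⟩ := Polynomial.lifts_and_degree_eq_and_monic hl (minpoly.monic hx)
    refine ⟨g, hgm, ?_⟩
    rw [IsScalarTower.algebraMap_eq ℤ_[2] ℚ_[2] F, ← Polynomial.eval₂_map, hg]
    exact minpoly.aeval _ _

instance isLocalRing_integers : IsLocalRing (Integers F) := by
  have hmul : ∀ x y : F, spectralNorm ℚ_[2] F (x * y) =
      spectralNorm ℚ_[2] F x * spectralNorm ℚ_[2] F y := spectralAlgNorm_mul
  have key : ∀ a : Integers F, a ∈ nonunits (Integers F) ↔ spectralNorm ℚ_[2] F (a : F) < 1 := by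
    intro a
    have ha := (mem_integers_iff F a).1 a.2
    rw [mem_nonunits_iff]
    constructor
    · intro h
      refine lt_of_le_of_ne ha fun h1 ↦ h ?_
      have h0 : (a : F) ≠ 0 := by
        intro h0
        rw [h0, spectralNorm_zero] at h1
        exact zero_ne_one h1
      have hm := hmul (a : F) (a : F)⁻¹
      rw [mul_inv_cancel₀ h0, spectralNorm_one, h1, one_mul] at hm
      exact IsUnit.of_mul_eq_one ⟨(a : F)⁻¹, (mem_integers_iff F _).2 hm.symm.le⟩
        (Subtype.ext (mul_inv_cancel₀ h0))
    · rintro h ⟨u, rfl⟩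
      have hm := hmul ((u : Integers F) : F) (((u⁻¹ : (Integers F)ˣ) : Integers F) : F)
      have h1 : (((u : Integers F) : F) * (((u⁻¹ : (Integers F)ˣ) : Integers F) : F)) = 1 := by
        rw [← Subalgebra.coe_mul, Units.mul_inv, Subalgebra.coe_one]
      rw [h1, spectralNorm_one] at hm
      have hu := (mem_integers_iff F _).1 ((u⁻¹ : (Integers F)ˣ) : Integers F).2
      have hn := spectralNorm_nonneg (K := ℚ_[2]) ((u : Integers F) : F)
      nlinarith
  refine IsLocalRing.of_nonunits_add fun a b ha hb ↦ ?_
  rw [key] at *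
  exact (isNonarchimedean_spectralNorm (K := ℚ_[2]) (L := F) (a : F) (b : F)).trans_lt
    (max_lt ha hb)

/-- The maximal ideal `𝔭_F` of `𝒪_F`. -/
def maxIdeal : Ideal (Integers F) := IsLocalRing.maximalIdeal (Integers F)

/-- The cardinality `q_F` of the residue field `𝒪_F / 𝔭_F`. -/
def residueCard : ℕ := Nat.card (Integers F ⧸ maxIdeal F)

/-- The absolute ramification index `e_F = e(F / ℚ₂)`. -/
def absRamificationIdx : ℕ := (maxIdeal F).ramificationIdx ℤ_[2]

end Integers

/-! ### Ramification and discriminants of extensions of `2`-adic fields -/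

section Extension

variable (K L : Type*) [Field K] [Field L] [Algebra ℤ_[2] K] [Algebra ℤ_[2] L]
  [Algebra K L] [IsScalarTower ℤ_[2] K L]

/-- The inclusion `𝒪_K → 𝒪_L` for an extension `L / K`. -/
def integersMap : Integers K →+* Integers L :=
  (((IsScalarTower.toAlgHom ℤ_[2] K L).comp (Integers K).val).codRestrict (Integers L)
    (fun x ↦ x.2.map (IsScalarTower.toAlgHom ℤ_[2] K L))).toRingHom

/-- `L / K` is totally ramified: `e(L / K) = [L : K]`. -/
def IsTotallyRamified [Algebra ℚ_[2] L] [IsScalarTower ℤ_[2] ℚ_[2] L]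
    [Algebra.IsAlgebraic ℚ_[2] L] : Prop :=
  letI := (integersMap K L).toAlgebra
  (maxIdeal L).ramificationIdx (Integers K) = Module.finrank K L

/-- The discriminant ideal `d_{L/K}`: the ideal of `𝒪_K` generated by the discriminants of all
`K`-bases of `L` that consist of elements of `𝒪_L`. -/
def discrIdeal : Ideal (Integers K) :=
  Ideal.span {d | ∃ b : Module.Basis (Fin (Module.finrank K L)) K L,
    (∀ i, b i ∈ Integers L) ∧ (d : K) = Algebra.discr K b}

/-- The valuation `v_K(d_{L/K})`: the exponent of `𝔭_K` in the discriminant ideal. -/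
def discrVal [Algebra ℚ_[2] K] [IsScalarTower ℤ_[2] ℚ_[2] K] [Algebra.IsAlgebraic ℚ_[2] K] : ℕ :=
  multiplicity (maxIdeal K) (discrIdeal K L)

variable {K L} in
/-- The discriminant ideal depends only on the isomorphism class of the extension. -/
theorem discrIdeal_le_of_algEquiv {M : Type*} [Field M] [Algebra ℤ_[2] M]
    [Algebra K M] [IsScalarTower ℤ_[2] K M] (f : L ≃ₐ[K] M) :
    discrIdeal K L ≤ discrIdeal K M := by
  refine Ideal.span_mono ?_
  rintro d ⟨b, hb, hd⟩
  have hr : Module.finrank K L = Module.finrank K M := f.toLinearEquiv.finrank_eq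
  refine ⟨(b.map f.toLinearEquiv).reindex (finCongr hr), fun i ↦ ?_, ?_⟩
  · rw [mem_integralClosure_iff, Module.Basis.reindex_apply, Module.Basis.map_apply]
    exact (hb ((finCongr hr).symm i)).map (f.toAlgHom.restrictScalars ℤ_[2])
  · rw [hd, Module.Basis.coe_reindex, Algebra.discr_reindex, Algebra.discr_eq_discr_of_algEquiv b f]
    rfl

end Extension

/-! ### Isomorphism classes of extensions and their mass -/

section Mass

variable (K : Type*) [Field K]

/-- Two extensions of `K` inside the algebraic closure are identified if they are isomorphic
over `K`. -/
instance extSetoid : Setoid (IntermediateField K (AlgebraicClosure K)) where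
  r L M := Nonempty (L ≃ₐ[K] M)
  iseqv := ⟨fun _ ↦ ⟨AlgEquiv.refl⟩, fun ⟨f⟩ ↦ ⟨f.symm⟩, fun ⟨f⟩ ⟨g⟩ ↦ ⟨f.trans g⟩⟩

/-- The isomorphism classes of algebraic extensions `L / K`, each of which is represented inside
the algebraic closure of `K`. -/
def ExtClass : Type _ := Quotient (extSetoid K)

variable {K} in
/-- The Galois closure group of `L / K` is isomorphic to `G`: `Gal(L̃ / K) ≅ G`, where `L̃` is the
normal closure of `L` over `K`. -/
def HasGaloisClosureGroup (L : IntermediateField K (AlgebraicClosure K)) (G : Type*) [Group G] :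
    Prop :=
  Nonempty (Gal(normalClosure K L (AlgebraicClosure K)/K) ≃* G)

/-- The Klein four-group. -/
abbrev V4 : Type := Multiplicative (ZMod 2) × Multiplicative (ZMod 2)

variable [Algebra ℤ_[2] K] [Algebra ℚ_[2] K] [IsScalarTower ℤ_[2] ℚ_[2] K]
  [Algebra.IsAlgebraic ℚ_[2] K]

instance isScalarTower_intermediateField (L : IntermediateField K (AlgebraicClosure K)) :
    IsScalarTower ℤ_[2] ℚ_[2] L := by
  refine IsScalarTower.of_algebraMap_eq' ?_
  rw [IsScalarTower.algebraMap_eq ℤ_[2] K L, IsScalarTower.algebraMap_eq ℚ_[2] K L,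
    IsScalarTower.algebraMap_eq ℤ_[2] ℚ_[2] K, RingHom.comp_assoc]

instance isAlgebraic_intermediateField (L : IntermediateField K (AlgebraicClosure K)) :
    Algebra.IsAlgebraic ℚ_[2] L :=
  Algebra.IsAlgebraic.trans ℚ_[2] K L

/-- `Σ^G`: the set of isomorphism classes of totally ramified quartic extensions `L / K` whose
Galois closure group is isomorphic to `G`. -/
def totRamQuartics (G : Type*) [Group G] : Set (ExtClass K) :=
  {c | ∃ L : IntermediateField K (AlgebraicClosure K), Quotient.mk (extSetoid K) L = c ∧
    Module.finrank K L = 4 ∧ IsTotallyRamified K L ∧ HasGaloisClosureGroup L G}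

/-- The term `(#Aut(L/K))⁻¹ / q ^ v_K(d_{L/K})` of the isomorphism class of `L`. -/
def massTerm (c : ExtClass K) : ℝ :=
  Quotient.lift (fun L : IntermediateField K (AlgebraicClosure K) ↦
    (Nat.card Gal(L/K) : ℝ)⁻¹ / (residueCard K : ℝ) ^ discrVal K L)
    (by
      rintro L M ⟨f⟩
      have h1 : Nat.card Gal(L/K) = Nat.card Gal(M/K) :=
        Nat.card_congr (AlgEquiv.autCongr f).toEquiv
      have h2 : discrIdeal K L = discrIdeal K M :=
        le_antisymm (discrIdeal_le_of_algEquiv f) (discrIdeal_le_of_algEquiv f.symm)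
      simp only [h1, discrVal, h2]) c

/-- The mass `m̃(S) = ∑_{L ∈ S} (#Aut(L/K))⁻¹ / q ^ v_K(d_{L/K})`. -/
def mass (S : Set (ExtClass K)) : ℝ := ∑' c : S, massTerm K c

end Mass

end TwoAdic

end

/-! By Kummer theory the `V₄`-extensions of `K` are the fields `K(√v, √w)`, one for each subgroup
`{1, v, w, vw}` of order four in the finite group `Kˣ / Kˣ²`. Such a field is totally ramified
exactly when none of `v`, `w`, `vw` lies in the two-element group of unramified classes
(`totRamQuartics_V4_eq`), and then its discriminant exponent is the sum of those of its three
quadratic subfields (`IsBiquadratic.discrVal_eq`). Every such field has four automorphisms and six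
ordered pairs of generators, so with weight `w(a) = q ^ (-d(a))` on ramified classes and `0` on the
others, the mass is `1/24` of the sum of `w(a) w(b) w(ab)` over all pairs
(`mass_totRamQuartics_V4`).

The exponent `d` is read off a filtration of `Kˣ / Kˣ²`: the image `F_m` of the units congruent to
`1` modulo `𝔭 ^ (2(e - m))` has order `2 q ^ m` for `m ≤ e` (`card_classFiltration`), the whole
group has order `4 q ^ e`, and `d` equals `2m` on `F_m` outside `F_(m-1)` and `2e + 1` outside
`F_e`. Since the weight is constant on each shell, the pair sum obeys a recursion along the
filtration (`pairSumOn_step`), whose solution is a combination of geometric series of ratios `q⁻³`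
and `q⁻⁴`.

Two local facts carry the arithmetic. One is the formula for ramification in a quotient of the
Galois group, proved with a uniformizer of `L` (`IsInvolutionPair.mul_sq_eq`). The other is that a
`V₄`-extension with a larger residue field contains an unramified square root
(`exists_sqrt_of_not_isTotallyRamified`). -/

set_option linter.unusedSectionVars false

noncomputable section

namespace TwoAdic

/-! ### The absolute value extending that of `ℚ₂`, and integrality in terms of it. -/

section AbsoluteValue

variable (F : Type*) [Field F] [Algebra ℚ_[2] F] [Algebra.IsAlgebraic ℚ_[2] F]

/-- The absolute value of an algebraic extension of `ℚ₂` that extends the one of `ℚ₂`. -/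
def absv : AbsoluteValue F ℝ where
  toFun := spectralNorm ℚ_[2] F
  map_mul' := spectralAlgNorm_mul
  nonneg' := spectralNorm_nonneg
  eq_zero' x := ⟨fun h ↦ eq_zero_of_map_spectralNorm_eq_zero h (Algebra.IsAlgebraic.isAlgebraic x), fun h ↦ h ▸ spectralNorm_zero⟩
  add_le' x y := (isNonarchimedean_spectralNorm x y).trans
    (max_le_add_of_nonneg (spectralNorm_nonneg _) (spectralNorm_nonneg _))

variable {F}

theorem absv_isNonarchimedean : IsNonarchimedean (absv F) :=
  isNonarchimedean_spectralNorm

theorem absv_add_le (x y : F) : absv F (x + y) ≤ max (absv F x) (absv F y) :=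
  absv_isNonarchimedean x y

theorem absv_sub_le (x y : F) : absv F (x - y) ≤ max (absv F x) (absv F y) := by
  rw [sub_eq_add_neg, ← (absv F).map_neg y]
  exact absv_add_le _ _

theorem absv_add_of_lt {x y : F} (h : absv F x < absv F y) : absv F (x + y) = absv F y := by
  refine le_antisymm ((absv_add_le x y).trans (max_le h.le le_rfl)) (le_of_not_gt fun h' ↦ ?_)
  have := absv_sub_le (x + y) x
  rw [add_sub_cancel_left] at this
  exact absurd this (not_le.2 (max_lt h' h))

theorem absv_algebraMap {L : Type*} [Field L] [Algebra ℚ_[2] L] [Algebra.IsAlgebraic ℚ_[2] L]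
    [Algebra F L] [IsScalarTower ℚ_[2] F L] (x : F) : absv L (algebraMap F L x) = absv F x :=
  (spectralNorm.eq_of_tower x).symm

omit [Algebra.IsAlgebraic ℚ_[2] F] in
theorem absv_algEquiv {L : Type*} [Field L] [Algebra ℚ_[2] L] [Algebra.IsAlgebraic ℚ_[2] L]
    [Algebra F L] [IsScalarTower ℚ_[2] F L] (σ : Gal(L/F)) (x : L) : absv L (σ x) = absv L x :=
  spectralNorm_eq_of_equiv (σ.restrictScalars ℚ_[2]) x |>.symm

theorem absv_two_lt : absv F 2 < 1 := by
  have h : absv F (algebraMap ℚ_[2] F 2) = ‖(2 : ℚ_[2])‖ := spectralNorm_extends _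
  rw [map_ofNat] at h
  rw [h]
  exact_mod_cast Padic.norm_p_lt_one (p := 2)

theorem absv_two_pos : 0 < absv F 2 := by
  have h : absv F (algebraMap ℚ_[2] F 2) = ‖(2 : ℚ_[2])‖ := spectralNorm_extends _
  rw [map_ofNat] at h
  rw [h]
  simp

theorem two_ne_zero' : (2 : F) ≠ 0 := (absv F).pos_iff.1 absv_two_pos

variable [Algebra ℤ_[2] F] [IsScalarTower ℤ_[2] ℚ_[2] F]

theorem mem_integers_iff_absv (x : F) : x ∈ Integers F ↔ absv F x ≤ 1 := mem_integers_iff F x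

theorem isUnit_integers_iff (x : Integers F) : IsUnit x ↔ absv F x = 1 := by
  have hx := (mem_integers_iff_absv (x : F)).1 x.2
  constructor
  · rintro ⟨u, rfl⟩
    have hu := (mem_integers_iff_absv (F := F) _).1 ((u⁻¹ : (Integers F)ˣ) : Integers F).2
    have h1 : (((u : Integers F) : F) * (((u⁻¹ : (Integers F)ˣ) : Integers F) : F)) = 1 := by
      rw [← Subalgebra.coe_mul, Units.mul_inv, Subalgebra.coe_one]
    have h2 := congrArg (absv F) h1
    rw [map_mul, map_one] at h2
    have hn := (absv F).nonneg ((u : Integers F) : F)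
    nlinarith
  · intro h
    have h0 : (x : F) ≠ 0 := fun h0 ↦ by simp [h0] at h
    exact IsUnit.of_mul_eq_one ⟨(x : F)⁻¹, (mem_integers_iff_absv _).2 (by simp [h])⟩
      (Subtype.ext (mul_inv_cancel₀ h0))

theorem mem_maxIdeal_iff (x : Integers F) : x ∈ maxIdeal F ↔ absv F x < 1 := by
  rw [maxIdeal, IsLocalRing.mem_maximalIdeal, mem_nonunits_iff, isUnit_integers_iff]
  exact ⟨fun h ↦ lt_of_le_of_ne ((mem_integers_iff_absv (x : F)).1 x.2) h, fun h ↦ h.ne⟩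

end AbsoluteValue

/-! ### Discreteness: uniformizers, powers of the maximal ideal, the ramification index. -/

section LocalField

variable (K : Type*) [Field K] [Algebra ℚ_[2] K] [FiniteDimensional ℚ_[2] K]
    [Algebra ℤ_[2] K] [IsScalarTower ℤ_[2] ℚ_[2] K]

instance finite_integers : Module.Finite ℤ_[2] (Integers K) :=
  IsIntegralClosure.finite ℤ_[2] ℚ_[2] K (Integers K)

theorem not_isField_integers : ¬ IsField (Integers K) := by
  intro h
  have h2 : absv K ((2 : Integers K) : K) = 1 := by
    rw [← isUnit_integers_iff]
    obtain ⟨b, hb⟩ := h.mul_inv_cancel (a := (2 : Integers K)) fun h ↦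
      two_ne_zero' (F := K) (congrArg Subtype.val h)
    exact IsUnit.of_mul_eq_one b hb
  exact (absv_two_lt (F := K)).ne h2

instance isDedekindDomain_integers : IsDedekindDomain (Integers K) :=
  integralClosure.isDedekindDomain ℤ_[2] ℚ_[2] K

instance isDiscreteValuationRing_integers : IsDiscreteValuationRing (Integers K) :=
  ((IsDiscreteValuationRing.TFAE _ (not_isField_integers K)).out 0 2).2
    (isDedekindDomain_integers K)

theorem exists_uniformizer : ∃ ϖ : K, 0 < absv K ϖ ∧ absv K ϖ < 1 ∧
    ∀ c : K, c ≠ 0 → ∃ n : ℤ, absv K c = absv K ϖ ^ n := by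
  obtain ⟨p, hp⟩ := IsDiscreteValuationRing.exists_irreducible (Integers K)
  have hp0 : (p : K) ≠ 0 := fun h ↦ hp.ne_zero (Subtype.ext h)
  have key : ∀ c : Integers K, c ≠ 0 → ∃ n : ℕ, absv K c = absv K p ^ n := by
    intro c hc
    obtain ⟨n, u, h⟩ := IsDiscreteValuationRing.eq_unit_mul_pow_irreducible hc hp
    refine ⟨n, ?_⟩
    rw [h, Subalgebra.coe_mul, map_mul, (isUnit_integers_iff _).1 u.isUnit, one_mul,
      Subalgebra.coe_pow, map_pow]
  refine ⟨p, (absv K).pos hp0, ?_, fun c hc ↦ ?_⟩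
  · rw [← mem_maxIdeal_iff]
    exact hp.not_isUnit
  · rcases le_total (absv K c) 1 with h | h
    · obtain ⟨n, hn⟩ := key ⟨c, (mem_integers_iff_absv c).2 h⟩ (fun h ↦ hc congr(($h : K)))
      exact ⟨n, by simpa using hn⟩
    · obtain ⟨n, hn⟩ := key ⟨c⁻¹, (mem_integers_iff_absv _).2 (by
        rw [map_inv₀]; exact inv_le_one_of_one_le₀ h)⟩ (fun h ↦ inv_ne_zero hc congr(($h : K)))
      refine ⟨-n, ?_⟩
      simp only [map_inv₀] at hn
      rw [zpow_neg, zpow_natCast, ← hn, inv_inv]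

/-- A uniformizer of a `2`-adic field. -/
def unif : K := (exists_uniformizer K).choose

/-- The absolute value of a uniformizer. -/
def rho : ℝ := absv K (unif K)

theorem absv_unif : absv K (unif K) = rho K := rfl

theorem rho_pos : 0 < rho K := (exists_uniformizer K).choose_spec.1

theorem rho_lt_one : rho K < 1 := (exists_uniformizer K).choose_spec.2.1

variable {K}

theorem unif_ne_zero : unif K ≠ 0 := (absv K).pos_iff.1 (rho_pos K)

theorem exists_absv_eq {c : K} (hc : c ≠ 0) : ∃ n : ℤ, absv K c = rho K ^ n :=
  (exists_uniformizer K).choose_spec.2.2 c hc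

theorem rho_zpow_le {m n : ℤ} : rho K ^ m ≤ rho K ^ n ↔ n ≤ m :=
  zpow_le_zpow_iff_right_of_lt_one₀ (rho_pos K) (rho_lt_one K)

theorem rho_zpow_lt {m n : ℤ} : rho K ^ m < rho K ^ n ↔ n < m :=
  zpow_lt_zpow_iff_right_of_lt_one₀ (rho_pos K) (rho_lt_one K)

theorem rho_zpow_inj {m n : ℤ} : rho K ^ m = rho K ^ n ↔ m = n :=
  zpow_right_inj₀ (rho_pos K) (rho_lt_one K).ne

theorem lt_rho_zpow_iff {c : K} {n : ℤ} : absv K c < rho K ^ n ↔ absv K c ≤ rho K ^ (n + 1) := by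
  rcases eq_or_ne c 0 with rfl | hc
  · simp [zpow_pos (rho_pos K), (zpow_pos (rho_pos K) _).le]
  · obtain ⟨m, hm⟩ := exists_absv_eq hc
    rw [hm, rho_zpow_le, rho_zpow_lt]
    omega

/-- The uniformizer as an integer. -/
def unifInt (K : Type*) [Field K] [Algebra ℚ_[2] K] [FiniteDimensional ℚ_[2] K]
    [Algebra ℤ_[2] K] [IsScalarTower ℤ_[2] ℚ_[2] K] : Integers K :=
  ⟨unif K, (mem_integers_iff_absv _).2 (rho_lt_one K).le⟩

theorem mem_span_iff_absv_le (x d : Integers K) :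
    x ∈ Ideal.span {d} ↔ absv K x ≤ absv K d := by
  rw [Ideal.mem_span_singleton]
  constructor
  · rintro ⟨c, rfl⟩
    rw [Subalgebra.coe_mul, map_mul]
    exact mul_le_of_le_one_right ((absv K).nonneg _) ((mem_integers_iff_absv _).1 c.2)
  · intro h
    rcases eq_or_ne (d : K) 0 with hd | hd
    · rw [hd, map_zero] at h
      have hx : x = 0 := Subtype.ext ((absv K).eq_zero.1 (le_antisymm h ((absv K).nonneg _)))
      exact hx ▸ dvd_zero _
    · refine ⟨⟨x / d, (mem_integers_iff_absv _).2 ?_⟩, Subtype.ext (mul_div_cancel₀ _ hd).symm⟩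
      rw [map_div₀]
      exact div_le_one_of_le₀ h ((absv K).nonneg _)

theorem maxIdeal_eq_span : maxIdeal K = Ideal.span {unifInt K} := by
  ext x
  rw [mem_maxIdeal_iff, mem_span_iff_absv_le]
  have := lt_rho_zpow_iff (c := (x : K)) (n := 0)
  rw [zpow_zero, zero_add, zpow_one] at this
  exact this

theorem mem_maxIdeal_pow_iff (x : Integers K) (n : ℕ) :
    x ∈ maxIdeal K ^ n ↔ absv K x ≤ rho K ^ n := by
  rw [maxIdeal_eq_span, Ideal.span_singleton_pow, mem_span_iff_absv_le, Subalgebra.coe_pow,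
    map_pow]
  rfl

theorem span_eq_maxIdeal_pow {d : Integers K} {n : ℕ} (h : absv K d = rho K ^ n) :
    Ideal.span {d} = maxIdeal K ^ n := by
  ext x
  rw [mem_span_iff_absv_le, mem_maxIdeal_pow_iff, h]

theorem maxIdeal_ne_bot : maxIdeal K ≠ ⊥ := by
  rw [maxIdeal_eq_span, Ne, Ideal.span_singleton_eq_bot]
  exact fun h ↦ unif_ne_zero congr(($h : K))

instance isMaximal_maxIdeal : (maxIdeal K).IsMaximal := IsLocalRing.maximalIdeal.isMaximal _

theorem multiplicity_maxIdeal_pow (n : ℕ) : multiplicity (maxIdeal K) (maxIdeal K ^ n) = n :=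
  multiplicity_pow_self maxIdeal_ne_bot (fun h ↦
    (isMaximal_maxIdeal (K := K)).ne_top (Ideal.isUnit_iff.1 h)) n

variable (K)

theorem map_under_maxIdeal : ((maxIdeal K).under ℤ_[2]).map (algebraMap ℤ_[2] (Integers K)) =
    Ideal.span {(2 : Integers K)} := by
  have hu : (maxIdeal K).under ℤ_[2] = IsLocalRing.maximalIdeal ℤ_[2] :=
    IsLocalRing.eq_maximalIdeal inferInstance
  rw [hu, PadicInt.maximalIdeal_eq_span_p, Ideal.map_span, Set.image_singleton, map_natCast,
    Nat.cast_ofNat]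

theorem exists_absv_two : ∃ n : ℕ, absv K 2 = rho K ^ n := by
  obtain ⟨n, hn⟩ := exists_absv_eq (two_ne_zero' (F := K))
  have hn0 : 0 ≤ n := by
    rw [← rho_zpow_le (K := K), ← hn, zpow_zero]
    exact absv_two_lt.le
  obtain ⟨m, rfl⟩ := Int.eq_ofNat_of_zero_le hn0
  exact ⟨m, by rw [hn, zpow_natCast]⟩

/-- The only way `e` enters the computations: the ideal-theoretic index is turned into the valuation
of `2`. -/
theorem absv_two : absv K 2 = rho K ^ absRamificationIdx K := by
  have h20 : (2 : Integers K) ≠ 0 := fun h ↦ two_ne_zero' (F := K) congr(($h : K))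
  obtain ⟨n, hn⟩ := exists_absv_two K
  have hn' : Ideal.span {(2 : Integers K)} = maxIdeal K ^ n := span_eq_maxIdeal_pow hn
  have h : absRamificationIdx K = n := by
    rw [absRamificationIdx, Ideal.IsDedekindDomain.ramificationIdx_eq_multiplicity
      ((maxIdeal K).under ℤ_[2]) (maxIdeal K), map_under_maxIdeal, hn', multiplicity_maxIdeal_pow]
    rw [map_under_maxIdeal, Ne, Ideal.span_singleton_eq_bot]
    exact h20
  rw [hn, h]

theorem absRamificationIdx_pos : 0 < absRamificationIdx K := by
  refine Nat.pos_of_ne_zero fun h ↦ ?_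
  have := absv_two K
  rw [h, pow_zero] at this
  exact absv_two_lt.ne this

instance hasFiniteQuotients_padicInt : Ring.HasFiniteQuotients ℤ_[2] where
  finiteQuotient hI :=
    IsLocalRing.isOpen_iff_finite_quotient.1 (IsDiscreteValuationRing.isOpen_iff.2 hI)

instance finite_residue : Finite (Integers K ⧸ maxIdeal K) :=
  (Ring.HasFiniteQuotients.of_module_finite ℤ_[2] (Integers K)).finiteQuotient maxIdeal_ne_bot

end LocalField

/-! ### The local square theorem. -/

section Squares

variable {K : Type*} [Field K] [Algebra ℚ_[2] K] [FiniteDimensional ℚ_[2] K]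

theorem charZero_of_algebra_padic (K : Type*) [Field K] [Algebra ℚ_[2] K] : CharZero K :=
  charZero_of_injective_algebraMap (algebraMap ℚ_[2] K).injective

/-- A Krasner-type argument. If `y² = a`, then `(y - 1)(y + 1) = a - 1` is smaller than `4`, so one
of `y`, `-y` is closer to `1` than `|2|`. A conjugation changing the sign of that root would give
two elements at distance `|2|`, both closer than `|2|` to `1`; hence the root is Galois-invariant
and lies in `K`. -/
theorem exists_sq_of_absv_sub_one_lt {a : K} (h : absv K (a - 1) < absv K 4) :
    ∃ s : K, a = s ^ 2 := by
  have := charZero_of_algebra_padic K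
  have hΩ : Algebra.IsAlgebraic ℚ_[2] (AlgebraicClosure K) := Algebra.IsAlgebraic.trans _ K _
  obtain ⟨y, hy⟩ := IsAlgClosed.exists_pow_nat_eq
    (algebraMap K (AlgebraicClosure K) a) (n := 2) two_pos
  have h2 : (4 : K) = 2 * 2 := by norm_num
  have hnear : ∃ z : AlgebraicClosure K, z ^ 2 = algebraMap K _ a ∧
      absv _ (z - 1) < absv (AlgebraicClosure K) 2 := by
    by_contra! hc
    have h1 := hc y hy
    have h1' := hc (-y) (by rw [neg_sq, hy])
    rw [← (absv (AlgebraicClosure K)).map_neg (-y - 1)] at h1'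
    have h3 : absv (AlgebraicClosure K) ((y - 1) * -(-y - 1)) = absv K (a - 1) := by
      have : algebraMap K (AlgebraicClosure K) (a - 1) = (y - 1) * -(-y - 1) := by
        rw [map_sub, ← hy, map_one]; ring
      rw [← absv_algebraMap (L := AlgebraicClosure K) (a - 1), this]
    have h4 : absv (AlgebraicClosure K) (2 * 2) = absv K 4 := by
      have : algebraMap K (AlgebraicClosure K) (2 * 2) = 2 * 2 := by rw [map_mul, map_ofNat]
      rw [h2, ← absv_algebraMap (L := AlgebraicClosure K) (2 * 2 : K), this]
    rw [← h3, ← h4, map_mul, map_mul] at h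
    exact absurd h (not_lt.2 (mul_le_mul h1 h1' ((absv _).nonneg _) ((absv _).nonneg _)))
  obtain ⟨z, hz, hz1⟩ := hnear
  have hfix : ∀ σ : Gal(AlgebraicClosure K/K), σ z = z := by
    intro σ
    have hs : (σ z) ^ 2 = z ^ 2 := by rw [← map_pow, hz, σ.commutes]
    rcases sq_eq_sq_iff_eq_or_eq_neg.1 hs with h | h
    · exact h
    · exfalso
      have h5 := absv_algEquiv σ (z - 1)
      rw [map_sub, map_one, h] at h5
      have h6 := absv_add_le (z - 1) (-z - 1)
      rw [h5, max_self, ← (absv (AlgebraicClosure K)).map_neg] at h6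
      have h7 : -(z - 1 + (-z - 1)) = 2 := by ring
      rw [h7] at h6
      exact absurd hz1 (not_lt.2 h6)
  obtain ⟨s, hs⟩ := (InfiniteGalois.mem_bot_iff_fixed z).2 hfix
  refine ⟨s, (algebraMap K (AlgebraicClosure K)).injective ?_⟩
  rw [map_pow, ← hz, ← hs]
  rfl

end Squares

/-! ### The unit filtration modulo squares, and the number of square classes. -/

section Units

variable (K : Type*) [Field K] [Algebra ℚ_[2] K] [FiniteDimensional ℚ_[2] K]
    [Algebra ℤ_[2] K] [IsScalarTower ℤ_[2] ℚ_[2] K]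

/-- The group `U^(n)` of units congruent to `1` modulo `𝔭 ^ n`. -/
def higherUnits (n : ℕ) : Subgroup Kˣ where
  carrier := {u | absv K u = 1 ∧ absv K (u - 1 : K) ≤ rho K ^ n}
  one_mem' := by simp [(pow_pos (rho_pos K) n).le]
  mul_mem' := by
    rintro u v ⟨hu, hu'⟩ ⟨hv, hv'⟩
    refine ⟨by simp [hu, hv], ?_⟩
    have : ((u * v : Kˣ) : K) - 1 = u * (v - 1) + (u - 1) := by push_cast; ring
    rw [this]
    refine (absv_add_le _ _).trans (max_le ?_ hu')
    rwa [map_mul, hu, one_mul]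
  inv_mem' := by
    rintro u ⟨hu, hu'⟩
    refine ⟨by simp [hu], ?_⟩
    have : ((u⁻¹ : Kˣ) : K) - 1 = -((u⁻¹ : Kˣ) * (u - 1)) := by simp [mul_sub]
    rw [this, (absv K).map_neg, map_mul]
    simpa [hu] using hu'

/-- The group of squares. -/
def squares : Subgroup Kˣ := (powMonoidHom 2 : Kˣ →* Kˣ).range

variable {K}

theorem mem_higherUnits {n : ℕ} {u : Kˣ} :
    u ∈ higherUnits K n ↔ absv K u = 1 ∧ absv K (u - 1 : K) ≤ rho K ^ n := Iff.rfl

theorem mem_squares {u : Kˣ} : u ∈ squares K ↔ ∃ s : Kˣ, s ^ 2 = u := Iff.rfl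

theorem mem_squares_iff_exists {u : Kˣ} : u ∈ squares K ↔ ∃ s : K, (u : K) = s ^ 2 := by
  rw [mem_squares]
  constructor
  · rintro ⟨s, rfl⟩
    exact ⟨s, by simp⟩
  · rintro ⟨s, hs⟩
    have h0 : s ≠ 0 := by
      rintro rfl
      exact u.ne_zero (by rw [hs, zero_pow two_ne_zero])
    exact ⟨Units.mk0 s h0, Units.ext (by simp [hs])⟩

theorem mem_sup_squares {H : Subgroup Kˣ} {a : Kˣ} :
    a ∈ H ⊔ squares K ↔ ∃ s : Kˣ, a / s ^ 2 ∈ H := by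
  rw [Subgroup.mem_sup]
  constructor
  · rintro ⟨y, hy, _, ⟨s, rfl⟩, rfl⟩
    exact ⟨s, by simpa using hy⟩
  · rintro ⟨s, hs⟩
    exact ⟨_, hs, s ^ 2, ⟨s, rfl⟩, div_mul_cancel _ _⟩

theorem higherUnits_anti {m n : ℕ} (h : m ≤ n) : higherUnits K n ≤ higherUnits K m :=
  fun _ hu ↦ ⟨hu.1, hu.2.trans (pow_le_pow_of_le_one (rho_pos K).le (rho_lt_one K).le h)⟩

theorem mk_eq_mk_iff {x y : Integers K} :
    Ideal.Quotient.mk (maxIdeal K) x = Ideal.Quotient.mk (maxIdeal K) y ↔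
      absv K (x - y : K) < 1 := by
  rw [Ideal.Quotient.eq, mem_maxIdeal_iff, Subalgebra.coe_sub]

instance charP_residue : CharP (Integers K ⧸ maxIdeal K) 2 := by
  refine CharTwo.of_one_ne_zero_of_two_eq_zero (fun h ↦ ?_) ?_
  · rw [← map_one (Ideal.Quotient.mk (maxIdeal K)), Ideal.Quotient.eq_zero_iff_mem] at h
    exact (Ideal.ne_top_iff_one _).1 (isMaximal_maxIdeal (K := K)).ne_top h
  · rw [← map_ofNat (Ideal.Quotient.mk (maxIdeal K)), Ideal.Quotient.eq_zero_iff_mem,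
      mem_maxIdeal_iff]
    exact absv_two_lt

theorem exists_sq_residue (w : Integers K) : ∃ z : Integers K, absv K (w - z ^ 2 : K) < 1 := by
  let : Field (Integers K ⧸ maxIdeal K) := Ideal.Quotient.field _
  obtain ⟨z, hz⟩ := (bijective_frobenius (Integers K ⧸ maxIdeal K) 2).2
    (Ideal.Quotient.mk (maxIdeal K) w)
  obtain ⟨z, rfl⟩ := Ideal.Quotient.mk_surjective z
  rw [frobenius_def, ← map_pow] at hz
  have := mk_eq_mk_iff.1 hz.symm
  exact ⟨z, by simpa using this⟩

theorem one_lt_residueCard : 1 < residueCard K := by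
  have : Nontrivial (Integers K ⧸ maxIdeal K) :=
    Ideal.Quotient.nontrivial_iff.2 (isMaximal_maxIdeal (K := K)).ne_top
  exact Finite.one_lt_card

theorem absv_sub_div_sq {u s : K} (h : absv K (s ^ 2) = 1) :
    absv K (u / s ^ 2 - 1) = absv K (u - s ^ 2) := by
  have h0 : s ^ 2 ≠ 0 := fun h0 ↦ by simp [h0] at h
  rw [div_sub_one h0, map_div₀, h, div_one]

theorem absv_eq_one_of_sub_lt {u s : K} (hu : absv K u = 1) (h : absv K (u - s) < 1) :
    absv K s = 1 := by
  have := absv_add_of_lt (x := -(u - s)) (y := u) (by rwa [(absv K).map_neg, hu])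
  rwa [neg_sub, sub_add_cancel, hu] at this

/-- The residue field is perfect: if `u = 1 + π ^ (2j) x` and `x ≡ z²`, then `u` agrees with `(1 + π
^ j z)²` to one more order. -/
theorem higherUnits_even_le {j : ℕ} (hj : j < absRamificationIdx K) :
    higherUnits K (2 * j) ≤ higherUnits K (2 * j + 1) ⊔ squares K := by
  rintro u ⟨hu, hu'⟩
  have hπ : (unif K) ^ (2 * j) ≠ 0 := pow_ne_zero _ unif_ne_zero
  have hρ := rho_pos K
  obtain ⟨z, hz⟩ := exists_sq_residue (K := K) ⟨(u - 1) / unif K ^ (2 * j),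
    (mem_integers_iff_absv _).2 (by
      rw [map_div₀, map_pow, absv_unif]
      exact div_le_one_of_le₀ hu' (pow_pos hρ _).le)⟩
  set s : K := 1 + unif K ^ j * z with hs
  have hz1 := (mem_integers_iff_absv (z : K)).1 z.2
  have key : absv K (u - s ^ 2 : K) ≤ rho K ^ (2 * j + 1) := by
    have : (u - s ^ 2 : K) = unif K ^ (2 * j) * ((u - 1) / unif K ^ (2 * j) - z ^ 2) -
        2 * unif K ^ j * z := by
      rw [mul_sub, mul_div_cancel₀ _ hπ, hs]; ring
    rw [this]
    refine (absv_sub_le _ _).trans (max_le ?_ ?_)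
    · rw [map_mul, map_pow, absv_unif, pow_succ (rho K)]
      refine mul_le_mul_of_nonneg_left ?_ (pow_pos hρ _).le
      have := (lt_rho_zpow_iff (c := ((u - 1) / unif K ^ (2 * j) - z ^ 2 : K)) (n := 0)).1
        (by rw [zpow_zero]; exact hz)
      rwa [zero_add, zpow_one] at this
    -- The cross term has valuation at least `e + j`, which is at least `2j + 1` because `j < e`.
    · rw [map_mul, map_mul, map_pow, absv_unif, absv_two, ← pow_add]
      exact (mul_le_of_le_one_right (pow_pos hρ _).le hz1).trans
        (pow_le_pow_of_le_one hρ.le (rho_lt_one K).le (by omega))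
  have hs1 : absv K (s ^ 2) = 1 := absv_eq_one_of_sub_lt hu
    (key.trans_lt (pow_lt_one₀ hρ.le (rho_lt_one K) (by omega)))
  have hs0 : s ≠ 0 := fun h ↦ by simp [h] at hs1
  refine mem_sup_squares.2 ⟨Units.mk0 s hs0, ?_⟩
  have hc : ((u / (Units.mk0 s hs0) ^ 2 : Kˣ) : K) = u / s ^ 2 := by simp
  rw [mem_higherUnits, hc]
  refine ⟨by rw [map_div₀, hs1, hu, div_one], ?_⟩
  rwa [absv_sub_div_sq hs1]

theorem absv_sq_sub_one (s : K) : absv K (s - 1) ≤ absv K 2 ∧ absv K (s ^ 2 - 1) ≤ absv K 4 ∨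
    absv K 2 < absv K (s - 1) ∧ absv K (s ^ 2 - 1) = absv K (s - 1) ^ 2 := by
  have h : s ^ 2 - 1 = (s - 1) * (2 + (s - 1)) := by ring
  rcases le_or_gt (absv K (s - 1)) (absv K 2) with h1 | h1
  · refine Or.inl ⟨h1, ?_⟩
    have h4 : (4 : K) = 2 * 2 := by norm_num
    rw [h, h4, map_mul, map_mul]
    exact mul_le_mul h1 ((absv_add_le _ _).trans (max_le le_rfl h1)) ((absv K).nonneg _)
      ((absv K).nonneg _)
  · refine Or.inr ⟨h1, ?_⟩
    rw [h, map_mul, absv_add_of_lt h1, sq]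

variable (K) in
theorem absv_four : absv K 4 = rho K ^ (2 * absRamificationIdx K) := by
  have h4 : (4 : K) = 2 ^ 2 := by norm_num
  rw [h4, map_pow, absv_two, ← pow_mul, mul_comm]

/-- Odd levels below `2e` receive no new squares: by `absv_sq_sub_one`, `s² - 1` is either divisible
by `4` or of even valuation. -/
theorem higherUnits_odd_inf {j : ℕ} (hj : j < absRamificationIdx K) :
    (higherUnits K (2 * j + 2) ⊔ squares K) ⊓ higherUnits K (2 * j + 1) =
      higherUnits K (2 * j + 2) := by
  refine le_antisymm ?_ (le_inf le_sup_left (higherUnits_anti (by omega)))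
  rintro u ⟨hu, hu1⟩
  obtain ⟨v, hv, _, ⟨s, rfl⟩, rfl⟩ := Subgroup.mem_sup.1 hu
  refine mul_mem hv ?_
  have hs : (powMonoidHom 2) s ∈ higherUnits K (2 * j + 1) := by
    have := mul_mem (inv_mem (higherUnits_anti (by omega) hv)) hu1
    rwa [inv_mul_cancel_left] at this
  refine ⟨hs.1, ?_⟩
  have h2 := hs.2
  rw [powMonoidHom_apply, Units.val_pow_eq_pow_val] at h2 ⊢
  rcases absv_sq_sub_one (s : K) with ⟨-, h⟩ | ⟨h, h'⟩
  · rw [absv_four] at h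
    exact h.trans (pow_le_pow_of_le_one (rho_pos K).le (rho_lt_one K).le (by omega))
  · have h0 : (s : K) - 1 ≠ 0 := (absv K).pos_iff.1 (((absv K).nonneg _).trans_lt h)
    obtain ⟨n, hn⟩ := exists_absv_eq h0
    rw [h', hn, ← zpow_natCast, ← zpow_natCast, ← zpow_mul, rho_zpow_le] at h2 ⊢
    push_cast at *
    omega

/-- The homomorphism `u ↦ (u - 1) / t` from `U^(n)` to the residue field, where `t` generates
`𝔭 ^ n` and `n` is positive. -/
def unitResidue {n : ℕ} (hn : 0 < n) {t : K} (ht : absv K t = rho K ^ n) :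
    higherUnits K n →* Multiplicative (Integers K ⧸ maxIdeal K) where
  toFun u := Multiplicative.ofAdd (Ideal.Quotient.mk (maxIdeal K) ⟨((u : Kˣ) - 1 : K) / t,
    (mem_integers_iff_absv _).2 (by
      rw [map_div₀, ht]
      exact div_le_one_of_le₀ u.2.2 (pow_pos (rho_pos K) _).le)⟩)
  map_one' := by
    rw [ofAdd_eq_one, Ideal.Quotient.eq_zero_iff_mem, mem_maxIdeal_iff]
    simp
  map_mul' u v := by
    rw [← ofAdd_add, ← map_add]
    congr 1
    rw [mk_eq_mk_iff]
    have ht0 : 0 < absv K t := ht ▸ pow_pos (rho_pos K) n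
    -- The defect of additivity is `(u - 1)(v - 1) / t`, of valuation at least `n`; it vanishes in
    -- the residue field because `n > 0`.
    have : (((u * v : higherUnits K n) : Kˣ) - 1 : K) / t -
        ((((u : Kˣ) - 1 : K) / t + ((v : Kˣ) - 1 : K) / t : K)) =
        ((u : Kˣ) - 1 : K) * ((v : Kˣ) - 1 : K) / t := by
      push_cast; ring
    rw [Subalgebra.coe_add, this, map_div₀, map_mul, div_lt_one ht0, ht]
    have hu := u.2.2
    have hv := v.2.2
    have hp : rho K ^ n < 1 := pow_lt_one₀ (rho_pos K).le (rho_lt_one K) hn.ne'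
    have hp0 := pow_pos (rho_pos K) n
    calc _ ≤ rho K ^ n * rho K ^ n := mul_le_mul hu hv ((absv K).nonneg _) hp0.le
      _ < rho K ^ n := mul_lt_of_lt_one_left hp0 hp

theorem unitResidue_eq_iff {n : ℕ} (hn : 0 < n) {t : K} (ht : absv K t = rho K ^ n)
    (u : higherUnits K n) (x : Integers K) :
    unitResidue hn ht u = Multiplicative.ofAdd (Ideal.Quotient.mk (maxIdeal K) x) ↔
      absv K (((u : Kˣ) - 1 : K) / t - x) < 1 := by
  rw [← mk_eq_mk_iff (x := ⟨((u : Kˣ) - 1 : K) / t, _⟩)]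
  exact Multiplicative.ofAdd.injective.eq_iff

theorem unitResidue_surjective {n : ℕ} (hn : 0 < n) {t : K} (ht : absv K t = rho K ^ n) :
    Function.Surjective (unitResidue hn ht) := by
  intro x
  obtain ⟨x, rfl⟩ := Multiplicative.ofAdd.surjective x
  obtain ⟨x, rfl⟩ := Ideal.Quotient.mk_surjective x
  have hx := (mem_integers_iff_absv (x : K)).1 x.2
  have ht0 : 0 < absv K t := ht ▸ pow_pos (rho_pos K) n
  have h1 : absv K (t * x) ≤ rho K ^ n := by
    rw [map_mul, ht]
    exact mul_le_of_le_one_right (pow_pos (rho_pos K) _).le hx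
  have h2 : absv K (1 + t * x) = 1 := by
    refine absv_eq_one_of_sub_lt (map_one _) ?_
    rw [sub_add_cancel_left, (absv K).map_neg]
    exact h1.trans_lt (pow_lt_one₀ (rho_pos K).le (rho_lt_one K) hn.ne')
  refine ⟨⟨Units.mk0 (1 + t * x) (fun h ↦ by simp [h] at h2), h2, by simpa using h1⟩, ?_⟩
  rw [unitResidue_eq_iff]
  simp [(absv K).pos_iff.1 ht0]

theorem higherUnits_relIndex {n : ℕ} (hn : 0 < n) :
    (higherUnits K (n + 1)).relIndex (higherUnits K n) = residueCard K := by
  have ht : absv K (unif K ^ n) = rho K ^ n := by rw [map_pow, absv_unif]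
  have : (higherUnits K (n + 1)).subgroupOf (higherUnits K n) = (unitResidue hn ht).ker := by
    ext u
    have h0 := unitResidue_eq_iff hn ht u 0
    rw [map_zero, ofAdd_zero, Subalgebra.coe_zero, sub_zero, map_div₀] at h0
    have h1 : absv K ((u : Kˣ) - 1 : K) / absv K (unif K ^ n) < 1 ↔
        absv K ((u : Kˣ) - 1 : K) ≤ rho K ^ ((n : ℤ) + 1) := by
      rw [ht, div_lt_one (pow_pos (rho_pos K) n), ← zpow_natCast, lt_rho_zpow_iff]
    rw [Subgroup.mem_subgroupOf, MonoidHom.mem_ker, h0, h1, mem_higherUnits]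
    exact ⟨fun h ↦ by exact_mod_cast h.2, fun h ↦ ⟨u.2.1, by exact_mod_cast h⟩⟩
  rw [Subgroup.relIndex, this, Subgroup.index_ker,
    MonoidHom.range_eq_top.2 (unitResidue_surjective hn ht), Subgroup.card_top]
  rfl

/-- The Artin-Schreier map `x ↦ x ^ 2 + x` in characteristic two. -/
def artinSchreier (k : Type*) [Field k] [CharP k 2] : k →+ k where
  toFun x := x ^ 2 + x
  map_zero' := by simp
  map_add' x y := by
    rw [CharTwo.add_sq]; ring

theorem index_range_artinSchreier (k : Type*) [Field k] [CharP k 2] [Finite k] :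
    (artinSchreier k).range.index = 2 := by
  have h1 := (artinSchreier k).ker.card_mul_index
  have h2 := (artinSchreier k).range.card_mul_index
  rw [AddSubgroup.index_ker, ← h2, mul_comm] at h1
  have hk : Nat.card (artinSchreier k).ker = 2 := by
    have : ((artinSchreier k).ker : Set k) = {0, 1} := by
      ext x
      simp only [SetLike.mem_coe, AddMonoidHom.mem_ker, Set.mem_insert_iff, Set.mem_singleton_iff]
      change x ^ 2 + x = 0 ↔ _
      rw [show x ^ 2 + x = x * (x + 1) by ring, mul_eq_zero, CharTwo.add_eq_zero]
    rw [← SetLike.coe_sort_coe, this, Nat.card_coe_set_eq, Set.ncard_pair zero_ne_one]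
  rw [← hk]
  exact (mul_left_cancel₀ Nat.card_pos.ne' h1).symm

/-- With `s = 1 + 2x` one has `(s² - 1) / 4 = x² + x`. Thus a unit `u ≡ 1` modulo `4` is a square
exactly when the residue of `(u - 1) / 4` is in the image of the Artin-Schreier map, which has index
two. The nontrivial class is that of the unramified quadratic extension. -/
theorem squares_relIndex_higherUnits :
    (squares K).relIndex (higherUnits K (2 * absRamificationIdx K)) = 2 := by
  let : Field (Integers K ⧸ maxIdeal K) := Ideal.Quotient.field _
  have hn : 0 < 2 * absRamificationIdx K := by have := absRamificationIdx_pos K; omega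
  have h40 : (4 : K) ≠ 0 := by
    have h := pow_pos (rho_pos K) (2 * absRamificationIdx K)
    rw [← absv_four] at h
    exact (absv K).pos_iff.1 h
  have : (squares K).subgroupOf (higherUnits K (2 * absRamificationIdx K)) =
      (AddSubgroup.toSubgroup (artinSchreier (Integers K ⧸ maxIdeal K)).range).comap
        (unitResidue hn (absv_four K)) := by
    ext u
    rw [Subgroup.mem_subgroupOf, Subgroup.mem_comap, mem_squares_iff_exists]
    have h2x : ∀ x : Integers K, absv K (2 * x : K) < 1 := fun x ↦ by
      rw [map_mul]
      exact mul_lt_one_of_nonneg_of_lt_one_left ((absv K).nonneg _) absv_two_lt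
        ((mem_integers_iff_absv (x : K)).1 x.2)
    have key : unitResidue hn (absv_four K) u ∈
        AddSubgroup.toSubgroup (artinSchreier (Integers K ⧸ maxIdeal K)).range ↔
        ∃ x : Integers K, absv K (((u : Kˣ) - 1 : K) / 4 - (x ^ 2 + x)) < 1 := by
      have : ∀ x : Integers K, absv K (((u : Kˣ) - 1 : K) / 4 - (x ^ 2 + x)) < 1 ↔
          unitResidue hn (absv_four K) u = Multiplicative.ofAdd
            (artinSchreier _ (Ideal.Quotient.mk (maxIdeal K) x)) := fun x ↦ by
        change _ ↔ _ = Multiplicative.ofAdd (Ideal.Quotient.mk (maxIdeal K) x ^ 2 +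
            Ideal.Quotient.mk (maxIdeal K) x)
        rw [← map_pow, ← map_add, unitResidue_eq_iff]
        simp
      simp only [this]
      constructor
      · rintro ⟨y, hy⟩
        obtain ⟨x, rfl⟩ := Ideal.Quotient.mk_surjective y
        exact ⟨x, congrArg Multiplicative.ofAdd hy.symm⟩
      · rintro ⟨x, hx⟩
        exact AddMonoidHom.mem_range.2
          ⟨Ideal.Quotient.mk (maxIdeal K) x, congrArg Multiplicative.toAdd hx.symm⟩
    rw [key]
    constructor
    · rintro ⟨s, hs⟩
      have hle : absv K (s - 1) ≤ absv K 2 := by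
        rcases absv_sq_sub_one s with h | ⟨h, h'⟩
        · exact h.1
        · exfalso
          have := u.2.2
          rw [hs, h', ← absv_four, show (4 : K) = 2 ^ 2 by norm_num, map_pow] at this
          exact absurd (pow_lt_pow_left₀ h ((absv K).nonneg _) two_ne_zero) (not_lt.2 this)
      refine ⟨⟨(s - 1) / 2, (mem_integers_iff_absv _).2 ?_⟩, ?_⟩
      · rw [map_div₀]
        exact div_le_one_of_le₀ hle ((absv K).nonneg _)
      · have h20 := two_ne_zero' (F := K)
        have : ((u : Kˣ) - 1 : K) / 4 - (((s - 1) / 2) ^ 2 + (s - 1) / 2) = 0 := by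
          rw [hs]; field_simp; ring
        simp [this]
    · rintro ⟨x, hx⟩
      set d : K := ((u : Kˣ) - 1 : K) / 4 - (x ^ 2 + x) with hd
      have hs1 : absv K ((1 + 2 * x : K)) = 1 := by
        refine absv_eq_one_of_sub_lt (map_one _) ?_
        rw [sub_add_cancel_left, (absv K).map_neg]
        exact h2x x
      have hs2 : absv K ((1 + 2 * x : K) ^ 2) = 1 := by rw [map_pow, hs1, one_pow]
      have hs0 : (1 + 2 * x : K) ≠ 0 := fun h ↦ by simp [h] at hs1
      -- Dividing by the approximate square root leaves an element within less than `|4|` of `1`, to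
      -- which the local square theorem applies.
      obtain ⟨r, hr⟩ := exists_sq_of_absv_sub_one_lt (a := (u : Kˣ) / (1 + 2 * x : K) ^ 2) (by
        rw [absv_sub_div_sq hs2]
        have : (u : Kˣ) - (1 + 2 * x : K) ^ 2 = 4 * d := by
          rw [hd, mul_sub, mul_div_cancel₀ _ h40]; ring
        rw [this, map_mul]
        exact mul_lt_of_lt_one_right ((absv K).pos h40) hx)
      refine ⟨r * (1 + 2 * x), ?_⟩
      rw [mul_pow, ← hr, div_mul_cancel₀ _ (pow_ne_zero _ hs0)]
  rw [Subgroup.relIndex, this, Subgroup.index_comap_of_surjective _ (unitResidue_surjective _ _)]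
  exact index_range_artinSchreier (Integers K ⧸ maxIdeal K)

theorem mem_sup_squares_zero {a : Kˣ} :
    a ∈ higherUnits K 0 ⊔ squares K ↔ ∃ n : ℤ, absv K a = rho K ^ (2 * n) := by
  rw [mem_sup_squares]
  constructor
  · rintro ⟨s, hs, -⟩
    obtain ⟨n, hn⟩ := exists_absv_eq s.ne_zero
    have hs2 : absv K s ^ 2 ≠ 0 := pow_ne_zero _ ((absv K).pos s.ne_zero).ne'
    refine ⟨n, ?_⟩
    rw [Units.val_div_eq_div_val, Units.val_pow_eq_pow_val, map_div₀, map_pow,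
      div_eq_one_iff_eq hs2] at hs
    rw [hs, hn, ← zpow_natCast, ← zpow_mul, mul_comm, Nat.cast_ofNat]
  · rintro ⟨n, hn⟩
    refine ⟨Units.mk0 (unif K) unif_ne_zero ^ n, ?_⟩
    have h1 : absv K ((a / (Units.mk0 (unif K) unif_ne_zero ^ n) ^ 2 : Kˣ) : K) = 1 := by
      rw [Units.val_div_eq_div_val, Units.val_pow_eq_pow_val, map_div₀, map_pow, hn,
        Units.val_zpow_eq_zpow_val, map_zpow₀, Units.val_mk0, absv_unif, ← zpow_natCast,
        ← zpow_mul, mul_comm, Nat.cast_ofNat, div_self (zpow_pos (rho_pos K) _).ne']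
    refine ⟨h1, ?_⟩
    rw [pow_zero]
    exact (absv_sub_le _ _).trans (by rw [h1, map_one, max_self])

theorem index_sup_squares_zero : (higherUnits K 0 ⊔ squares K).index = 2 := by
  rw [Subgroup.index_eq_two_iff]
  refine ⟨Units.mk0 (unif K) unif_ne_zero, fun b ↦ ?_⟩
  obtain ⟨m, hm⟩ := exists_absv_eq b.ne_zero
  rw [mem_sup_squares_zero, mem_sup_squares_zero, Units.val_mul, map_mul, hm, Units.val_mk0,
    absv_unif, ← zpow_add_one₀ (rho_pos K).ne']
  simp only [rho_zpow_inj]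
  rcases Int.even_or_odd' m with ⟨k, rfl | rfl⟩
  · exact Or.inr ⟨⟨k, rfl⟩, by rintro ⟨n, hn⟩; omega⟩
  · exact Or.inl ⟨⟨k + 1, by ring⟩, by rintro ⟨n, hn⟩; omega⟩

theorem sup_squares_even_eq {j : ℕ} (hj : j < absRamificationIdx K) :
    higherUnits K (2 * j) ⊔ squares K = higherUnits K (2 * j + 1) ⊔ squares K :=
  le_antisymm (sup_le (higherUnits_even_le hj) le_sup_right)
    (sup_le_sup_right (higherUnits_anti (by omega)) _)

/-- Of the two unit levels crossed, the even one is absorbed by squares and the odd one contributes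
the full residue field. -/
theorem sup_squares_relIndex {j : ℕ} (hj : j < absRamificationIdx K) :
    (higherUnits K (2 * j + 2) ⊔ squares K).relIndex (higherUnits K (2 * j) ⊔ squares K) =
      residueCard K := by
  have h : higherUnits K (2 * j + 1) ⊔ squares K =
      higherUnits K (2 * j + 1) ⊔ (higherUnits K (2 * j + 2) ⊔ squares K) := by
    rw [← sup_assoc, sup_eq_left.2 (higherUnits_anti (by omega))]
  rw [sup_squares_even_eq hj, h, Subgroup.relIndex_sup_right, ← Subgroup.inf_relIndex_right,
    higherUnits_odd_inf hj, higherUnits_relIndex (by omega)]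

variable (K) in
/-- The group of square classes. -/
abbrev SquareClass : Type _ := Kˣ ⧸ squares K

variable (K) in
/-- The square classes `a` such that `K(√a)` has discriminant exponent at most `2 m`. -/
def classFiltration (m : ℕ) : Subgroup (SquareClass K) :=
  (higherUnits K (2 * (absRamificationIdx K - m)) ⊔ squares K).map (QuotientGroup.mk' (squares K))

theorem mk_mem_classFiltration {m : ℕ} {a : Kˣ} :
    (a : SquareClass K) ∈ classFiltration K m ↔
      a ∈ higherUnits K (2 * (absRamificationIdx K - m)) ⊔ squares K := by
  have h := Subgroup.comap_map_eq (QuotientGroup.mk' (squares K))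
    (higherUnits K (2 * (absRamificationIdx K - m)) ⊔ squares K)
  rw [QuotientGroup.ker_mk', sup_assoc, sup_idem] at h
  rw [← h, Subgroup.mem_comap]
  rfl

theorem classFiltration_mono {m n : ℕ} (h : m ≤ n) :
    classFiltration K m ≤ classFiltration K n :=
  Subgroup.map_mono (sup_le_sup_right (higherUnits_anti (by omega)) _)

theorem card_classFiltration_eq (m : ℕ) : Nat.card (classFiltration K m) =
    (squares K).relIndex (higherUnits K (2 * (absRamificationIdx K - m)) ⊔ squares K) := by
  rw [classFiltration, ← Subgroup.relIndex_ker, QuotientGroup.ker_mk']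

/-- The base `m = 0` consists of the trivial and the unramified class; every further step
contributes a factor `q`. -/
theorem card_classFiltration {m : ℕ} (hm : m ≤ absRamificationIdx K) :
    Nat.card (classFiltration K m) = 2 * residueCard K ^ m := by
  induction m with
  | zero =>
    rw [card_classFiltration_eq, Subgroup.relIndex_sup_right, Nat.sub_zero,
      squares_relIndex_higherUnits, pow_zero, mul_one]
  | succ m ih =>
    have ih := ih (by omega)
    rw [card_classFiltration_eq] at ih ⊢
    have h := sup_squares_relIndex (K := K) (j := absRamificationIdx K - (m + 1)) (by omega)
    rw [show 2 * (absRamificationIdx K - (m + 1)) + 2 = 2 * (absRamificationIdx K - m) by omega]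
      at h
    rw [← Subgroup.relIndex_mul_relIndex _ _ _ le_sup_right
      (sup_le_sup_right (higherUnits_anti (K := K)
        (show 2 * (absRamificationIdx K - (m + 1)) ≤ 2 * (absRamificationIdx K - m) by omega)) _),
      ih, h, pow_succ, mul_assoc]

theorem card_squareClass :
    Nat.card (SquareClass K) = 4 * residueCard K ^ absRamificationIdx K := by
  have h := card_classFiltration (K := K) le_rfl
  rw [card_classFiltration_eq, Nat.sub_self, mul_zero] at h
  rw [← Subgroup.index_eq_card, ← Subgroup.relIndex_mul_index
    (le_sup_right : squares K ≤ higherUnits K 0 ⊔ squares K), h, index_sup_squares_zero]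
  ring

instance finite_squareClass : Finite (SquareClass K) := by
  refine Nat.finite_of_card_ne_zero ?_
  rw [card_squareClass]
  have := one_lt_residueCard (K := K)
  positivity

end Units

/-! ### Sums over pairs in a finite group with a weight constant off a subgroup. -/

section PairSums

variable {G : Type*} [Group G] [Fintype G]

open Classical in
/-- The sum of `w` over a subgroup. -/
def sumOn (w : G → ℝ) (H : Subgroup G) : ℝ := ∑ a with a ∈ H, w a

open Classical in
/-- The sum of `w a * w b * w (a * b)` over the pairs of elements of a subgroup. -/
def pairSumOn (w : G → ℝ) (H : Subgroup G) : ℝ :=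
  ∑ a with a ∈ H, ∑ b with b ∈ H, w a * w b * w (a * b)

open Classical in
theorem card_filter_mem (H : Subgroup G) :
    (Finset.univ.filter (· ∈ H)).card = Nat.card H := by
  rw [← Fintype.card_subtype, Nat.card_eq_fintype_card]

open Classical in
theorem sum_filter_mem_eq_add {A B : Subgroup G} (h : A ≤ B) (f : G → ℝ) :
    ∑ a with a ∈ B, f a = ∑ a with a ∈ A, f a + ∑ a with a ∈ B ∧ a ∉ A, f a := by
  rw [← Finset.sum_filter_add_sum_filter_not _ (· ∈ A), Finset.filter_filter,
    Finset.filter_filter]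
  congr 2
  ext a
  simpa using fun ha ↦ h ha

open Classical in
theorem card_filter_diff {A B : Subgroup G} (h : A ≤ B) :
    ((Finset.univ.filter (fun a ↦ a ∈ B ∧ a ∉ A)).card : ℝ) = Nat.card B - Nat.card A := by
  have := sum_filter_mem_eq_add h (fun _ ↦ (1 : ℝ))
  simp only [Finset.sum_const, nsmul_eq_mul, mul_one, card_filter_mem] at this
  linarith

open Classical in
theorem sum_filter_diff_const {A B : Subgroup G} (h : A ≤ B) {f : G → ℝ} {c : ℝ}
    (hf : ∀ a ∈ B, a ∉ A → f a = c) :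
    ∑ a with a ∈ B ∧ a ∉ A, f a = (Nat.card B - Nat.card A) * c := by
  rw [Finset.sum_congr rfl (g := fun _ ↦ c) (fun a ha ↦ by
    rw [Finset.mem_filter] at ha; exact hf a ha.2.1 ha.2.2), Finset.sum_const, nsmul_eq_mul,
    card_filter_diff h]

theorem sumOn_step {A B : Subgroup G} (h : A ≤ B) {w : G → ℝ} {c : ℝ}
    (hw : ∀ a ∈ B, a ∉ A → w a = c) :
    sumOn w B = sumOn w A + (Nat.card B - Nat.card A) * c := by
  rw [sumOn, sumOn, sum_filter_mem_eq_add h, sum_filter_diff_const h hw]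

open Classical in
theorem sum_filter_mem_mul_left {B : Subgroup G} {a : G} (ha : a ∈ B) (f : G → ℝ) :
    ∑ b with b ∈ B, f (a * b) = ∑ b with b ∈ B, f b := by
  refine Finset.sum_equiv (Equiv.mulLeft a) (fun b ↦ ?_) (fun b _ ↦ rfl)
  simp [B.mul_mem_cancel_left ha]

/-- Among `a`, `b`, `ab`, either all three lie in `A`, or exactly one, or none. One in `A` gives
three symmetric contributions `(|B| - |A|) c² ∑_A w`. For none, each `a` outside `A` leaves `|B| -
2|A|` choices of `b`, since `b` must avoid `A` and the disjoint coset `a⁻¹A`. -/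
theorem pairSumOn_step {A B : Subgroup G} (h : A ≤ B) {w : G → ℝ} {c : ℝ}
    (hw : ∀ a ∈ B, a ∉ A → w a = c) :
    pairSumOn w B = pairSumOn w A + 3 * (Nat.card B - Nat.card A) * c ^ 2 * sumOn w A +
      (Nat.card B - Nat.card A) * (Nat.card B - 2 * Nat.card A) * c ^ 3 := by
  classical
  have h1 : ∀ a ∈ A, ∑ b with b ∈ B, w a * w b * w (a * b) =
      ∑ b with b ∈ A, w a * w b * w (a * b) + (Nat.card B - Nat.card A) * c ^ 2 * w a := by
    intro a ha
    rw [sum_filter_mem_eq_add h, sum_filter_diff_const (c := w a * c ^ 2) h]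
    · ring
    · intro b hb hbA
      rw [hw b hb hbA, hw (a * b) (mul_mem (h ha) hb)
        (fun hab ↦ hbA ((A.mul_mem_cancel_left ha).1 hab))]
      ring
  have h2 : ∀ a ∈ B, a ∉ A → ∑ b with b ∈ B, w a * w b * w (a * b) =
      2 * c ^ 2 * sumOn w A + (Nat.card B - 2 * Nat.card A) * c ^ 3 := by
    intro a ha haA
    have h3 : ∑ b with b ∈ A, w a * w b * w (a * b) = c ^ 2 * sumOn w A := by
      rw [sumOn, Finset.mul_sum]
      refine Finset.sum_congr rfl fun b hb ↦ ?_
      have hb := (Finset.mem_filter.1 hb).2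
      rw [hw a ha haA, hw (a * b) (mul_mem ha (h hb))
        (fun hab ↦ haA ((A.mul_mem_cancel_right hb).1 hab))]
      ring
    -- Translation by `a` permutes `B`, so this is the sum of `w` over `B` minus the part with `b ∈
    -- A`, where `ab ∉ A` and the weight is `c`.
    have h4 : ∑ b with b ∈ B ∧ b ∉ A, w (a * b) =
        sumOn w A + (Nat.card B - 2 * Nat.card A) * c := by
      have h5 := sum_filter_mem_mul_left ha w
      have h6 : ∑ b with b ∈ A, w (a * b) = Nat.card A * c := by
        rw [← card_filter_mem, ← nsmul_eq_mul, ← Finset.sum_const]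
        refine Finset.sum_congr rfl fun b hb ↦ ?_
        have hb := (Finset.mem_filter.1 hb).2
        exact hw (a * b) (mul_mem ha (h hb)) (fun hab ↦ haA ((A.mul_mem_cancel_right hb).1 hab))
      have h7 := sumOn_step h hw
      rw [sum_filter_mem_eq_add h, h6] at h5
      rw [sumOn] at h7
      linarith
    have h8 : ∑ b with b ∈ B ∧ b ∉ A, w a * w b * w (a * b) =
        c ^ 2 * ∑ b with b ∈ B ∧ b ∉ A, w (a * b) := by
      rw [Finset.mul_sum]
      refine Finset.sum_congr rfl fun b hb ↦ ?_
      have hb := (Finset.mem_filter.1 hb).2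
      rw [hw a ha haA, hw b hb.1 hb.2]
      ring
    rw [sum_filter_mem_eq_add h, h3, h8, h4]
    ring
  rw [pairSumOn, sum_filter_mem_eq_add h, sum_filter_diff_const h h2,
    Finset.sum_congr rfl (fun a ha ↦ h1 a (Finset.mem_filter.1 ha).2), Finset.sum_add_distrib,
    ← Finset.mul_sum, pairSumOn, sumOn]
  ring

end PairSums

/-! ### The pair sum over all square classes in closed form. -/

section Weights

variable (K : Type*) [Field K] [Algebra ℚ_[2] K] [FiniteDimensional ℚ_[2] K]
    [Algebra ℤ_[2] K] [IsScalarTower ℤ_[2] ℚ_[2] K]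

open Classical in
/-- The exponent of the discriminant of `K(√a)` for a square class `a`. -/
def discExp (a : SquareClass K) : ℕ :=
  if a ∈ classFiltration K (absRamificationIdx K) then 2 * sInf {m | a ∈ classFiltration K m}
  else 2 * absRamificationIdx K + 1

open Classical in
/-- The contribution of a square class to the mass: zero for unramified classes. -/
def weight (a : SquareClass K) : ℝ :=
  if a ∈ classFiltration K 0 then 0 else (residueCard K : ℝ)⁻¹ ^ discExp K a

variable {K}

theorem discExp_of_mem {m : ℕ} (hm : m + 1 ≤ absRamificationIdx K) {a : SquareClass K}
    (ha : a ∈ classFiltration K (m + 1)) (ha' : a ∉ classFiltration K m) :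
    discExp K a = 2 * (m + 1) := by
  rw [discExp, if_pos (classFiltration_mono hm ha)]
  congr 1
  refine le_antisymm (Nat.sInf_le ha) (le_csInf ⟨_, ha⟩ fun n hn ↦ ?_)
  by_contra! h
  exact ha' (classFiltration_mono (by omega) hn)

theorem discExp_of_notMem {a : SquareClass K}
    (ha : a ∉ classFiltration K (absRamificationIdx K)) :
    discExp K a = 2 * absRamificationIdx K + 1 := if_neg ha

theorem weight_of_notMem {a : SquareClass K} (ha : a ∉ classFiltration K 0) :
    weight K a = (residueCard K : ℝ)⁻¹ ^ discExp K a := if_neg ha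

theorem weight_of_mem {a : SquareClass K} (ha : a ∈ classFiltration K 0) : weight K a = 0 :=
  if_pos ha

theorem exists_level {a : SquareClass K} (ha : a ∈ classFiltration K (absRamificationIdx K))
    (h0 : a ∉ classFiltration K 0) : ∃ m, m + 1 ≤ absRamificationIdx K ∧
      a ∈ classFiltration K (m + 1) ∧ a ∉ classFiltration K m := by
  classical
  have hex : ∃ n, a ∈ classFiltration K n := ⟨_, ha⟩
  obtain ⟨m, hm⟩ : ∃ m, Nat.find hex = m + 1 :=
    Nat.exists_eq_add_one_of_ne_zero fun h ↦ h0 (h ▸ Nat.find_spec hex)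
  exact ⟨m, hm ▸ Nat.find_min' hex ha, hm ▸ Nat.find_spec hex, Nat.find_min hex (by omega)⟩

instance fintype_squareClass : Fintype (SquareClass K) := Fintype.ofFinite _

theorem classFiltration_le_succ (m : ℕ) : classFiltration K m ≤ classFiltration K (m + 1) :=
  classFiltration_mono m.le_succ

-- The shell between levels `m` and `m + 1` has `2 q ^ m (q - 1)` classes of weight `q ^ (-2(m +
-- 1))`, giving a geometric series of ratio `q⁻¹`.
open Classical in
theorem sumOn_weight {m : ℕ} (hm : m ≤ absRamificationIdx K) :
    sumOn (weight K) (classFiltration K m) =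
      2 * (1 - (residueCard K : ℝ)⁻¹ ^ m) * (residueCard K : ℝ)⁻¹ := by
  have hq : (residueCard K : ℝ) ≠ 0 := by
    have := one_lt_residueCard (K := K)
    positivity
  induction m with
  | zero =>
    rw [pow_zero, sub_self, mul_zero, zero_mul, sumOn]
    exact Finset.sum_eq_zero fun a ha ↦ weight_of_mem (Finset.mem_filter.1 ha).2
  | succ m ih =>
    rw [sumOn_step (classFiltration_le_succ m) (c := (residueCard K : ℝ)⁻¹ ^ (2 * (m + 1))),
      ih (by omega), card_classFiltration hm, card_classFiltration (by omega)]
    · push_cast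
      generalize (residueCard K : ℝ) = q at hq ⊢
      have e1 : q⁻¹ ^ (2 * (m + 1)) = ((q ^ m) ^ 2)⁻¹ * (q ^ 2)⁻¹ := by
        rw [inv_pow, ← mul_inv]; ring
      have e2 : q⁻¹ ^ (m + 1) = (q ^ m)⁻¹ * q⁻¹ := by rw [pow_succ, inv_pow]
      have e3 : q⁻¹ ^ m = (q ^ m)⁻¹ := inv_pow _ _
      rw [e1, e2, e3, pow_succ q m]
      have hX : q ^ m ≠ 0 := pow_ne_zero _ hq
      generalize q ^ m = X at hX ⊢
      field_simp
      ring
    · intro a ha ha'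
      rw [weight_of_notMem (fun h ↦ ha' (classFiltration_mono m.zero_le h)),
        discExp_of_mem hm ha ha']

-- The increment from level `m` to `m + 1` is a combination of `q ^ (-3m)` and `q ^ (-4m)`: the sum
-- over the lower level supplies `1 - q ^ (-m)`, whence the two series.
open Classical in
theorem pairSumOn_weight {m : ℕ} (hm : m ≤ absRamificationIdx K) {q : ℝ}
    (hq : q = residueCard K) :
    pairSumOn (weight K) (classFiltration K m) =
      12 * (q - 1) * q⁻¹ ^ 2 * ((1 - q⁻¹ ^ (3 * m)) / (q ^ 3 - 1)) +
      (4 * (q - 1) * (q - 2) * q⁻¹ ^ 2 - 12 * (q - 1) * q⁻¹) *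
        ((1 - q⁻¹ ^ (4 * m)) / (q ^ 4 - 1)) := by
  have hq1 : 1 < q := by
    rw [hq]
    exact_mod_cast one_lt_residueCard (K := K)
  have hq0 : q ≠ 0 := by positivity
  have hq3 : q ^ 3 - 1 ≠ 0 := (sub_pos.2 (one_lt_pow₀ hq1 three_ne_zero)).ne'
  have hq4 : q ^ 4 - 1 ≠ 0 := (sub_pos.2 (one_lt_pow₀ hq1 four_ne_zero)).ne'
  induction m with
  | zero =>
    rw [mul_zero, mul_zero, pow_zero, sub_self, zero_div, zero_div, mul_zero, mul_zero, add_zero,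
      pairSumOn]
    refine Finset.sum_eq_zero fun a ha ↦ Finset.sum_eq_zero fun b _ ↦ ?_
    rw [weight_of_mem (Finset.mem_filter.1 ha).2, zero_mul, zero_mul]
  | succ m ih =>
    rw [pairSumOn_step (classFiltration_le_succ m)
      (c := (residueCard K : ℝ)⁻¹ ^ (2 * (m + 1))),
      ih (by omega), sumOn_weight (by omega), card_classFiltration hm,
      card_classFiltration (by omega)]
    · push_cast
      rw [← hq]
      have e1 : q⁻¹ ^ (3 * (m + 1)) = (q⁻¹ ^ m) ^ 3 * q⁻¹ ^ 3 := by ring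
      have e2 : q⁻¹ ^ (4 * (m + 1)) = (q⁻¹ ^ m) ^ 4 * q⁻¹ ^ 4 := by ring
      have e3 : q⁻¹ ^ (2 * (m + 1)) = (q⁻¹ ^ m) ^ 2 * q⁻¹ ^ 2 := by ring
      have e4 : q⁻¹ ^ (3 * m) = (q⁻¹ ^ m) ^ 3 := by ring
      have e5 : q⁻¹ ^ (4 * m) = (q⁻¹ ^ m) ^ 4 := by ring
      have e6 : q⁻¹ ^ m = (q ^ m)⁻¹ := by rw [inv_pow]
      rw [e1, e2, e3, e4, e5, e6, pow_succ q m]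
      have hX : q ^ m ≠ 0 := pow_ne_zero _ hq0
      -- With `q ^ m` as an independent variable the claim is an identity of rational functions in
      -- `q` and `X`.
      generalize q ^ m = X at hX ⊢
      field_simp
      ring
    · intro a ha ha'
      rw [weight_of_notMem (fun h ↦ ha' (classFiltration_mono m.zero_le h)),
        discExp_of_mem hm ha ha']

/-- The last step adds the classes of odd valuation, of weight `q ^ (-2e - 1)`. Here the subgroup
has index two, so the cubic term of `pairSumOn_step` vanishes. -/
theorem pairSumOn_weight_top {q : ℝ} (hq : q = residueCard K) {e : ℤ}
    (he : e = absRamificationIdx K) :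
    pairSumOn (weight K) ⊤ =
      24 * ((q - 1) / 6 *
        (q ^ (-4 * e - 3) * ((q ^ (4 * e) - 1) / (q ^ 4 - 1)) * (3 * q ^ 3 + q ^ 2 + q + 3) -
          3 * q ^ (-3 * e - 3) * ((q ^ (3 * e) - 1) / (q ^ 3 - 1)) * (q ^ 2 + 1))) := by
  have hq1 : 1 < q := by
    rw [hq]
    exact_mod_cast one_lt_residueCard (K := K)
  have hq0 : q ≠ 0 := by positivity
  have hq3 : q ^ 3 - 1 ≠ 0 := (sub_pos.2 (one_lt_pow₀ hq1 three_ne_zero)).ne'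
  have hq4 : q ^ 4 - 1 ≠ 0 := (sub_pos.2 (one_lt_pow₀ hq1 four_ne_zero)).ne'
  rw [pairSumOn_step (A := classFiltration K (absRamificationIdx K)) le_top
    (c := (residueCard K : ℝ)⁻¹ ^ (2 * absRamificationIdx K + 1)), pairSumOn_weight le_rfl hq,
    sumOn_weight le_rfl, card_classFiltration le_rfl, Subgroup.card_top, card_squareClass]
  · push_cast
    rw [← hq]
    generalize absRamificationIdx K = n at *
    subst he
    have e1 : q ^ (-4 * (n : ℤ) - 3) = ((q ^ n) ^ 4)⁻¹ * (q ^ 3)⁻¹ := by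
      rw [zpow_sub₀ hq0, div_eq_mul_inv, neg_mul, zpow_neg, mul_comm, mul_comm (4 : ℤ),
        zpow_mul, zpow_natCast]
      rw [mul_comm]; norm_cast
    have e2 : q ^ (-3 * (n : ℤ) - 3) = ((q ^ n) ^ 3)⁻¹ * (q ^ 3)⁻¹ := by
      rw [zpow_sub₀ hq0, div_eq_mul_inv, neg_mul, zpow_neg, mul_comm, mul_comm (3 : ℤ),
        zpow_mul, zpow_natCast]
      rw [mul_comm]; norm_cast
    have e3 : q ^ (4 * (n : ℤ)) = (q ^ n) ^ 4 := by
      rw [mul_comm, zpow_mul, zpow_natCast]; norm_cast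
    have e4 : q ^ (3 * (n : ℤ)) = (q ^ n) ^ 3 := by
      rw [mul_comm, zpow_mul, zpow_natCast]; norm_cast
    have e5 : q⁻¹ ^ (3 * n) = ((q ^ n) ^ 3)⁻¹ := by rw [mul_comm, pow_mul, inv_pow, inv_pow]
    have e6 : q⁻¹ ^ (4 * n) = ((q ^ n) ^ 4)⁻¹ := by rw [mul_comm, pow_mul, inv_pow, inv_pow]
    have e7 : q⁻¹ ^ (2 * n + 1) = ((q ^ n) ^ 2)⁻¹ * q⁻¹ := by
      rw [pow_succ, mul_comm 2, pow_mul, inv_pow, inv_pow]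
    have e8 : q⁻¹ ^ n = (q ^ n)⁻¹ := inv_pow _ _
    rw [e1, e2, e3, e4, e5, e6, e7, e8]
    have hX : q ^ n ≠ 0 := pow_ne_zero _ hq0
    generalize q ^ n = X at hX ⊢
    field_simp
    ring
  · intro a _ ha'
    rw [weight_of_notMem (fun h ↦ ha' (classFiltration_mono (Nat.zero_le _) h)),
      discExp_of_notMem ha']

end Weights

/-! ### Galois theory of biquadratic extensions. -/

section Biquadratic

/-- `L = K(x, y)` is biquadratic, where `x` and `y` are square roots of elements of `K`. -/
structure IsBiquadratic (K : Type*) {L : Type*} [Field K] [Field L] [Algebra K L] (x y : L) :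
    Prop where
  sq_left : x ^ 2 ∈ (algebraMap K L).range
  sq_right : y ^ 2 ∈ (algebraMap K L).range
  left_notMem : x ∉ (algebraMap K L).range
  right_notMem : y ∉ (algebraMap K L).range
  mul_notMem : x * y ∉ (algebraMap K L).range
  adjoin_eq_top : IntermediateField.adjoin K {x, y} = ⊤

variable {K L : Type*} [Field K] [Field L] [Algebra K L]

theorem apply_eq_or_neg_of_sq_mem {z : L} (hz : z ^ 2 ∈ (algebraMap K L).range) (σ : Gal(L/K)) :
    σ z = z ∨ σ z = -z := by
  obtain ⟨c, hc⟩ := hz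
  apply sq_eq_sq_iff_eq_or_eq_neg.1
  rw [← map_pow, ← hc, σ.commutes]

theorem mem_range_of_forall_fixed [IsGalois K L] [FiniteDimensional K L] {z : L}
    (h : ∀ σ : Gal(L/K), σ z = z) : z ∈ (algebraMap K L).range :=
  (IsGalois.mem_range_algebraMap_iff_fixed z).2 h

theorem apply_eq_of_mem_range {z : L} (h : z ∈ (algebraMap K L).range) (σ : Gal(L/K)) :
    σ z = z := by
  obtain ⟨c, rfl⟩ := h
  exact σ.commutes c

theorem exists_apply_eq_neg [IsGalois K L] [FiniteDimensional K L] {z : L}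
    (hz : z ^ 2 ∈ (algebraMap K L).range) (hz' : z ∉ (algebraMap K L).range) :
    ∃ σ : Gal(L/K), σ z = -z := by
  by_contra! h
  exact hz' (mem_range_of_forall_fixed fun σ ↦
    (apply_eq_or_neg_of_sq_mem hz σ).resolve_right (h σ))

namespace IsBiquadratic

variable {x y : L} (h : IsBiquadratic K x y)

include h

theorem symm : IsBiquadratic K y x :=
  ⟨h.sq_right, h.sq_left, h.right_notMem, h.left_notMem, mul_comm x y ▸ h.mul_notMem,
    Set.pair_comm x y ▸ h.adjoin_eq_top⟩

theorem left_ne_zero : x ≠ 0 := fun h0 ↦ h.left_notMem (h0 ▸ zero_mem _)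

theorem right_ne_zero : y ≠ 0 := h.symm.left_ne_zero

theorem ext_of_apply_eq {σ τ : Gal(L/K)} (hx : σ x = τ x) (hy : σ y = τ y) : σ = τ := by
  have : (σ : L →ₐ[K] L) = τ := by
    refine AlgHom.ext fun z ↦ ?_
    have hz : z ∈ IntermediateField.adjoin K {x, y} := h.adjoin_eq_top ▸ IntermediateField.mem_top
    induction hz using IntermediateField.adjoin_induction with
    | mem z hz =>
      rcases hz with rfl | rfl
      · exact hx
      · exact hy
    | algebraMap c => simp
    | add z w _ _ hz hw => rw [map_add, map_add, hz, hw]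
    | mul z w _ _ hz hw => rw [map_mul, map_mul, hz, hw]
    | inv z _ hz => rw [map_inv₀, map_inv₀, hz]
  exact AlgEquiv.ext fun z ↦ DFunLike.congr_fun this z

variable [IsGalois K L] [FiniteDimensional K L]

/-- Take `σ` moving `x`. If it also moves `y`, take `τ` moving `xy`: either `τ` moves only `x`, or
it moves only `y` and `στ` moves only `x`. -/
theorem exists_neg_fix : ∃ σ : Gal(L/K), σ x = -x ∧ σ y = y := by
  obtain ⟨σ, hσ⟩ := exists_apply_eq_neg h.sq_left h.left_notMem
  rcases apply_eq_or_neg_of_sq_mem h.sq_right σ with hy | hy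
  · exact ⟨σ, hσ, hy⟩
  obtain ⟨τ, hτ⟩ := exists_apply_eq_neg (z := x * y)
    (by rw [mul_pow]; exact mul_mem h.sq_left h.sq_right) h.mul_notMem
  rw [map_mul] at hτ
  rcases apply_eq_or_neg_of_sq_mem h.sq_left τ with hx' | hx'
  · rw [hx', ← mul_neg] at hτ
    have hy' := mul_left_cancel₀ h.left_ne_zero hτ
    exact ⟨σ * τ, by rw [AlgEquiv.mul_apply, hx', hσ],
      by rw [AlgEquiv.mul_apply, hy', map_neg, hy, neg_neg]⟩
  · rw [hx', neg_mul, neg_inj] at hτ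
    exact ⟨τ, hx', mul_left_cancel₀ h.left_ne_zero hτ⟩

theorem exists_fix_neg : ∃ σ : Gal(L/K), σ x = x ∧ σ y = -y := by
  obtain ⟨σ, h1, h2⟩ := h.symm.exists_neg_fix
  exact ⟨σ, h2, h1⟩

theorem exists_generators [CharZero K] : ∃ s t : Gal(L/K), (s x = x ∧ s y = -y) ∧
    (t x = -x ∧ t y = y) ∧ (∀ σ, σ = 1 ∨ σ = s ∨ σ = t ∨ σ = s * t) ∧
    s ≠ 1 ∧ t ≠ 1 ∧ s ≠ t := by
  have : CharZero L := charZero_of_injective_algebraMap (algebraMap K L).injective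
  obtain ⟨s, hs, hs'⟩ := h.exists_fix_neg
  obtain ⟨t, ht, ht'⟩ := h.exists_neg_fix
  have hx : -x ≠ x := neg_ne_self.2 h.left_ne_zero
  have hy : -y ≠ y := neg_ne_self.2 h.right_ne_zero
  refine ⟨s, t, ⟨hs, hs'⟩, ⟨ht, ht'⟩, fun σ ↦ ?_, ?_, ?_, ?_⟩
  · rcases apply_eq_or_neg_of_sq_mem h.sq_left σ with h1 | h1 <;>
    rcases apply_eq_or_neg_of_sq_mem h.sq_right σ with h2 | h2
    · exact Or.inl (h.ext_of_apply_eq h1 h2)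
    · exact Or.inr (Or.inl (h.ext_of_apply_eq (h1.trans hs.symm) (h2.trans hs'.symm)))
    · exact Or.inr (Or.inr (Or.inl (h.ext_of_apply_eq (h1.trans ht.symm) (h2.trans ht'.symm))))
    · refine Or.inr (Or.inr (Or.inr (h.ext_of_apply_eq ?_ ?_)))
      · rw [h1, AlgEquiv.mul_apply, ht, map_neg, hs]
      · rw [h2, AlgEquiv.mul_apply, ht', hs']
  · rintro rfl; exact hy hs'.symm
  · rintro rfl; exact hx ht.symm
  · rintro rfl; exact hx (ht.symm.trans hs)

theorem isKleinFour [CharZero K] : IsKleinFour Gal(L/K) := by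
  have hsq : ∀ σ : Gal(L/K), σ ^ 2 = 1 := by
    intro σ
    refine h.ext_of_apply_eq ?_ ?_ <;> rw [sq, AlgEquiv.mul_apply, AlgEquiv.one_apply]
    · rcases apply_eq_or_neg_of_sq_mem h.sq_left σ with h1 | h1 <;> simp [h1]
    · rcases apply_eq_or_neg_of_sq_mem h.sq_right σ with h1 | h1 <;> simp [h1]
  obtain ⟨s, t, hs, ht, hall, hs1, ht1, hst⟩ := h.exists_generators
  have h2 : Monoid.exponent Gal(L/K) = 2 := by
    refine ((Nat.dvd_prime Nat.prime_two).1
      (Monoid.exponent_dvd_of_forall_pow_eq_one hsq)).resolve_left fun h1 ↦ hs1 ?_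
    have := Monoid.pow_exponent_eq_one s
    rwa [h1, pow_one] at this
  refine ⟨?_, h2⟩
  have hst1 : s * t ∉ ({s, t, 1} : Set Gal(L/K)) := by
    simpa using mul_notMem_of_exponent_two h2 hs1 ht1 hst
  have huniv : (Set.univ : Set Gal(L/K)) = {s * t, s, t, 1} := by
    ext σ
    have := hall σ
    simp only [Set.mem_univ, Set.mem_insert_iff, Set.mem_singleton_iff, true_iff]
    tauto
  rw [← Nat.card_univ, huniv, Nat.card_coe_set_eq, Set.ncard_insert_of_notMem hst1,
    Set.ncard_insert_of_notMem (by simp [hst, hs1]), Set.ncard_pair ht1]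

theorem finrank_eq_four [CharZero K] : Module.finrank K L = 4 := by
  rw [← IsGalois.card_aut_eq_finrank]
  exact h.isKleinFour.card_four

/-- Kummer theory: the signs by which the two generators act on `z` agree with those on one of `1`,
`x`, `y`, `xy`, and the quotient of `z` by that element is fixed. -/
theorem exists_of_sq_mem [CharZero K] {z : L} (hz : z ^ 2 ∈ (algebraMap K L).range) :
    ∃ c : K, z = algebraMap K L c ∨ z = algebraMap K L c * x ∨ z = algebraMap K L c * y ∨
      z = algebraMap K L c * (x * y) := by
  obtain ⟨s, t, ⟨hs, hs'⟩, ⟨ht, ht'⟩, hall, -⟩ := h.exists_generators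
  have key : ∀ m : L, m ≠ 0 → s (z / m) = z / m → t (z / m) = z / m →
      ∃ c : K, z = algebraMap K L c * m := by
    intro m hm h1 h2
    obtain ⟨c, hc⟩ := mem_range_of_forall_fixed (K := K) (z := z / m) fun σ ↦ by
      rcases hall σ with rfl | rfl | rfl | rfl
      · rfl
      · exact h1
      · exact h2
      · rw [AlgEquiv.mul_apply, h2, h1]
    exact ⟨c, by rw [hc, div_mul_cancel₀ _ hm]⟩
  have hx := h.left_ne_zero
  have hy := h.right_ne_zero
  rcases apply_eq_or_neg_of_sq_mem hz s with h1 | h1 <;>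
  rcases apply_eq_or_neg_of_sq_mem hz t with h2 | h2
  · obtain ⟨c, hc⟩ := key 1 one_ne_zero (by simp [h1]) (by simp [h2])
    exact ⟨c, Or.inl (by rw [hc, mul_one])⟩
  · obtain ⟨c, hc⟩ := key x hx (by simp [h1, hs]) (by simp [h2, ht])
    exact ⟨c, Or.inr (Or.inl hc)⟩
  · obtain ⟨c, hc⟩ := key y hy (by simp [h1, hs']) (by simp [h2, ht'])
    exact ⟨c, Or.inr (Or.inr (Or.inl hc))⟩
  · obtain ⟨c, hc⟩ := key (x * y) (mul_ne_zero hx hy)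
      (by simp [h1, hs, hs', div_neg, neg_div]) (by simp [h2, ht, ht', div_neg, neg_div])
    exact ⟨c, Or.inr (Or.inr (Or.inr hc))⟩

end IsBiquadratic

/-- By the Galois correspondence, an automorphism fixing the fixed field of `s` lies in `{1, s}`. -/
theorem exists_fix_ne [IsGalois K L] [FiniteDimensional K L] {s t : Gal(L/K)} (hs : s ^ 2 = 1)
    (ht : t ≠ 1) (hst : t ≠ s) : ∃ z : L, s z = z ∧ t z ≠ z := by
  by_contra! hc
  have h1 : t ∈ fixingSubgroup (fixedField (Subgroup.zpowers s)) := by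
    rw [IntermediateField.mem_fixingSubgroup_iff]
    intro z hz
    exact hc z ((IntermediateField.mem_fixedField_iff _ _).1 hz s (Subgroup.mem_zpowers s))
  rw [IntermediateField.fixingSubgroup_fixedField, Subgroup.mem_zpowers_iff] at h1
  obtain ⟨n, rfl⟩ := h1
  rcases Int.even_or_odd' n with ⟨k, rfl | rfl⟩
  · exact ht (by rw [zpow_mul, zpow_ofNat, hs, one_zpow])
  · exact hst (by rw [zpow_add, zpow_mul, zpow_ofNat, hs, one_zpow, one_mul, zpow_one])

theorem exists_isBiquadratic [IsGalois K L] [FiniteDimensional K L] [CharZero K]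
    [hG : IsKleinFour Gal(L/K)] : ∃ x y : L, IsBiquadratic K x y := by
  have : CharZero L := charZero_of_injective_algebraMap (algebraMap K L).injective
  have hsq : ∀ s : Gal(L/K), s ^ 2 = 1 := fun s ↦ by rw [sq, IsKleinFour.mul_self]
  have happ : ∀ (s : Gal(L/K)) (z : L), s (s z) = z := fun s z ↦ by
    rw [← AlgEquiv.mul_apply, IsKleinFour.mul_self, AlgEquiv.one_apply]
  have : Nontrivial Gal(L/K) := by
    rw [← Finite.one_lt_card_iff_nontrivial, hG.card_four]
    norm_num
  obtain ⟨s, hs⟩ := exists_ne (1 : Gal(L/K))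
  obtain ⟨t, ht⟩ : ∃ t : Gal(L/K), t ∉ ({1, s} : Set Gal(L/K)) := by
    by_contra! hc
    have h1 : (Set.univ : Set Gal(L/K)) = {1, s} := (Set.eq_univ_of_forall hc).symm
    have h2 := Set.ncard_pair hs.symm
    rw [← h1, Set.ncard_univ, hG.card_four] at h2
    omega
  rw [Set.mem_insert_iff, Set.mem_singleton_iff, not_or] at ht
  have hall : ∀ σ : Gal(L/K), σ = 1 ∨ σ = s ∨ σ = t ∨ σ = s * t := by
    intro σ
    by_contra! hc
    exact hc.2.2.2 (IsKleinFour.eq_mul_of_ne_all hs ht.1 (Ne.symm ht.2) hc.1 hc.2.1 hc.2.2.1)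
  have hcomm : s * t = t * s := (IsKleinFour.isMulCommutative (G := Gal(L/K))).is_comm.comm s t
  have hcomm' : ∀ z, s (t z) = t (s z) := fun z ↦ DFunLike.congr_fun hcomm z
  obtain ⟨z, hz, hz'⟩ := exists_fix_ne (hsq s) ht.1 ht.2
  obtain ⟨w, hw, hw'⟩ := exists_fix_ne (hsq t) hs (Ne.symm ht.2)
  have hx0 : z - t z ≠ 0 := sub_ne_zero.2 hz'.symm
  have hy0 : w - s w ≠ 0 := sub_ne_zero.2 hw'.symm
  -- Antisymmetrizing gives eigenvectors: `z - t z` is fixed by `s` and negated by `t`, and `w - s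
  -- w` the other way round.
  have hsx : s (z - t z) = z - t z := by rw [map_sub, hcomm', hz]
  have htx : t (z - t z) = -(z - t z) := by rw [map_sub, happ, neg_sub]
  have hty : t (w - s w) = w - s w := by rw [map_sub, ← hcomm', hw]
  have hsy : s (w - s w) = -(w - s w) := by rw [map_sub, happ, neg_sub]
  generalize z - t z = x at *
  generalize w - s w = y at *
  have hmem : ∀ u : L, s u = u → t u = u → u ∈ (algebraMap K L).range := fun u h1 h2 ↦
    mem_range_of_forall_fixed fun σ ↦ by
      rcases hall σ with rfl | rfl | rfl | rfl
      · rfl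
      · exact h1
      · exact h2
      · rw [AlgEquiv.mul_apply, h2, h1]
  refine ⟨x, y, hmem _ (by rw [map_pow, hsx]) (by rw [map_pow, htx, neg_sq]),
    hmem _ (by rw [map_pow, hsy, neg_sq]) (by rw [map_pow, hty]), fun h ↦ ?_, fun h ↦ ?_,
    fun h ↦ ?_, ?_⟩
  · exact neg_ne_self.2 hx0 (htx.symm.trans (apply_eq_of_mem_range h t))
  · exact neg_ne_self.2 hy0 (hsy.symm.trans (apply_eq_of_mem_range h s))
  · have := apply_eq_of_mem_range h s
    rw [map_mul, hsx, hsy, mul_neg] at this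
    exact neg_ne_self.2 (mul_ne_zero hx0 hy0) this
  · have hbot : fixingSubgroup (IntermediateField.adjoin K {x, y}) = ⊥ := by
      refine (Subgroup.eq_bot_iff_forall _).2 fun σ hσ ↦ ?_
      rw [IntermediateField.mem_fixingSubgroup_iff] at hσ
      have h1 := hσ x (IntermediateField.subset_adjoin K _ (by simp))
      have h2 := hσ y (IntermediateField.subset_adjoin K _ (by simp))
      rcases hall σ with rfl | rfl | rfl | rfl
      · rfl
      · exact absurd (hsy.symm.trans h2) (neg_ne_self.2 hy0)
      · exact absurd (htx.symm.trans h1) (neg_ne_self.2 hx0)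
      · rw [AlgEquiv.mul_apply, htx, map_neg, hsx] at h1
        exact absurd h1 (neg_ne_self.2 hx0)
    rw [← IsGalois.fixedField_fixingSubgroup (IntermediateField.adjoin K {x, y}), hbot,
      IntermediateField.fixedField_bot]

end Biquadratic

section Klein

instance isKleinFour_V4 : IsKleinFour V4 where
  card_four := by simp [V4]
  exponent_two := by
    rw [Monoid.exponent_prod, Monoid.exponent_multiplicative, ZMod.exponent]
    rfl

end Klein

/-! ### Biquadratic fields inside the algebraic closure, indexed by square classes. -/

section BiquadraticFields

variable {K : Type*} [Field K]

/-- A square root of a representative of a square class. -/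
def sqrtClass (v : SquareClass K) : AlgebraicClosure K :=
  (IsAlgClosed.exists_pow_nat_eq (algebraMap K (AlgebraicClosure K) (Quotient.out v : Kˣ))
    two_pos).choose

theorem sqrtClass_sq (v : SquareClass K) :
    sqrtClass v ^ 2 = algebraMap K (AlgebraicClosure K) (Quotient.out v : Kˣ) :=
  (IsAlgClosed.exists_pow_nat_eq (algebraMap K (AlgebraicClosure K) (Quotient.out v : Kˣ))
    two_pos).choose_spec

/-- The extension `K(√v, √w)`. -/
def biquad (v w : SquareClass K) : IntermediateField K (AlgebraicClosure K) :=
  IntermediateField.adjoin K {sqrtClass v, sqrtClass w}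

theorem out_eq (v : SquareClass K) : ((Quotient.out v : Kˣ) : SquareClass K) = v :=
  Quotient.out_eq v

theorem mk_eq_mk_of_sq {a b : Kˣ} {c : K} (h : (a : K) = c ^ 2 * b) :
    (a : SquareClass K) = (b : SquareClass K) := by
  have hc : c ≠ 0 := by
    rintro rfl
    exact a.ne_zero (by simp [h])
  rw [eq_comm, QuotientGroup.eq]
  refine ⟨Units.mk0 c hc, Units.ext ?_⟩
  simp [h, mul_comm]

theorem exists_sq_mul_of_mk_eq_mk {a b : Kˣ} (h : (a : SquareClass K) = (b : SquareClass K)) :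
    ∃ c : Kˣ, a = c ^ 2 * b := by
  rw [eq_comm, QuotientGroup.eq] at h
  obtain ⟨c, hc⟩ := h
  refine ⟨c, ?_⟩
  change c ^ 2 = _ at hc
  rw [hc, mul_comm b⁻¹, inv_mul_cancel_right]

theorem mk_eq_one_of_sq {a : Kˣ} {c : K} (h : (a : K) = c ^ 2) : (a : SquareClass K) = 1 :=
  mk_eq_mk_of_sq (b := 1) (c := c) (by simpa using h)

theorem mem_of_sq_eq {L : IntermediateField K (AlgebraicClosure K)} {z w : AlgebraicClosure K}
    (hz : z ∈ L) (h : z ^ 2 = w ^ 2) : w ∈ L := by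
  rcases sq_eq_sq_iff_eq_or_eq_neg.1 h with rfl | rfl
  · exact hz
  · exact neg_mem_iff.1 hz

/-- A field `L` contains a square root of every element of the class `mk a` as soon as it
contains one of `a`. -/
theorem sqrtClass_mem {L : IntermediateField K (AlgebraicClosure K)} {z : AlgebraicClosure K}
    (hz : z ∈ L) {a : Kˣ} (h : z ^ 2 = algebraMap K _ a) : sqrtClass (a : SquareClass K) ∈ L := by
  obtain ⟨c, hc⟩ := exists_sq_mul_of_mk_eq_mk (out_eq (a : SquareClass K))
  refine mem_of_sq_eq (z := algebraMap K _ (c : K) * z) (mul_mem (L.algebraMap_mem _) hz) ?_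
  rw [sqrtClass_sq, hc, mul_pow, h, ← map_pow, ← map_mul, Units.val_mul, Units.val_pow_eq_pow_val]

theorem sqrtClass_mul_mem {L : IntermediateField K (AlgebraicClosure K)} {v w : SquareClass K}
    (hv : sqrtClass v ∈ L) (hw : sqrtClass w ∈ L) : sqrtClass (v * w) ∈ L := by
  have := sqrtClass_mem (a := Quotient.out v * Quotient.out w) (mul_mem hv hw)
    (by rw [mul_pow, sqrtClass_sq, sqrtClass_sq, ← map_mul, Units.val_mul])
  rwa [QuotientGroup.mk_mul, out_eq, out_eq] at this

theorem left_mem_biquad (v w : SquareClass K) : sqrtClass v ∈ biquad v w :=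
  IntermediateField.subset_adjoin K _ (by simp)

theorem right_mem_biquad (v w : SquareClass K) : sqrtClass w ∈ biquad v w :=
  IntermediateField.subset_adjoin K _ (by simp)

theorem biquad_le_iff {L : IntermediateField K (AlgebraicClosure K)} {v w : SquareClass K} :
    biquad v w ≤ L ↔ sqrtClass v ∈ L ∧ sqrtClass w ∈ L := by
  rw [biquad, IntermediateField.adjoin_le_iff, Set.insert_subset_iff, Set.singleton_subset_iff]
  rfl

instance finiteDimensional_biquad (v w : SquareClass K) : FiniteDimensional K (biquad v w) :=
  IntermediateField.finiteDimensional_adjoin fun _ _ ↦ Algebra.IsIntegral.isIntegral _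

instance normal_biquad (v w : SquareClass K) : Normal K (biquad v w) := by
  rw [IntermediateField.normal_iff_forall_map_le']
  intro σ
  rw [IntermediateField.map_le_iff_le_comap, biquad_le_iff]
  refine ⟨mem_of_sq_eq (w := σ (sqrtClass v)) (left_mem_biquad v w) ?_,
    mem_of_sq_eq (w := σ (sqrtClass w)) (right_mem_biquad v w) ?_⟩ <;>
  · rw [← map_pow, sqrtClass_sq, σ.commutes]

theorem isGalois_biquad [CharZero K] (v w : SquareClass K) : IsGalois K (biquad v w) :=
  ⟨⟩

theorem mul_self_squareClass (v : SquareClass K) : v * v = 1 := by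
  rw [← out_eq v, ← QuotientGroup.mk_mul]
  exact mk_eq_one_of_sq (c := (Quotient.out v : Kˣ)) (by rw [sq, Units.val_mul])

theorem isBiquadratic_biquad {v w : SquareClass K} (hv : v ≠ 1) (hw : w ≠ 1) (hvw : v * w ≠ 1) :
    IsBiquadratic K (⟨sqrtClass v, left_mem_biquad v w⟩ : biquad v w)
      (⟨sqrtClass w, right_mem_biquad v w⟩ : biquad v w) := by
  have key : ∀ (z : biquad v w) (a : Kˣ), (z : AlgebraicClosure K) ^ 2 = algebraMap K _ a →
      (a : SquareClass K) ≠ 1 → z ∉ (algebraMap K (biquad v w)).range := by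
    rintro _ a hz ha ⟨c, rfl⟩
    refine ha (mk_eq_one_of_sq (c := c) ((algebraMap K (AlgebraicClosure K)).injective ?_))
    rw [← hz, map_pow]
    rfl
  refine ⟨⟨_, Subtype.ext (sqrtClass_sq v).symm⟩, ⟨_, Subtype.ext (sqrtClass_sq w).symm⟩,
    key _ _ (sqrtClass_sq v) (by rwa [out_eq]), key _ _ (sqrtClass_sq w) (by rwa [out_eq]),
    key _ (Quotient.out v * Quotient.out w) ?_ (by rwa [QuotientGroup.mk_mul, out_eq, out_eq]), ?_⟩
  · change (sqrtClass v * sqrtClass w) ^ 2 = _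
    rw [mul_pow, sqrtClass_sq, sqrtClass_sq, ← map_mul, Units.val_mul]
  · refine IntermediateField.map_injective (biquad v w).val ?_
    rw [IntermediateField.adjoin_map, Set.image_pair, ← AlgHom.fieldRange_eq_map,
      IntermediateField.fieldRange_val]
    rfl

variable [CharZero K]

theorem finrank_biquad {v w : SquareClass K} (hv : v ≠ 1) (hw : w ≠ 1) (hvw : v * w ≠ 1) :
    Module.finrank K (biquad v w) = 4 :=
  have := isGalois_biquad v w
  (isBiquadratic_biquad hv hw hvw).finrank_eq_four

theorem hasGaloisClosureGroup_biquad {v w : SquareClass K} (hv : v ≠ 1) (hw : w ≠ 1)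
    (hvw : v * w ≠ 1) : HasGaloisClosureGroup (biquad v w) V4 := by
  have := isGalois_biquad v w
  have := (isBiquadratic_biquad hv hw hvw).isKleinFour
  rw [HasGaloisClosureGroup, IntermediateField.normalClosure_of_normal]
  exact IsKleinFour.nonempty_mulEquiv

/-- The field determines the subgroup `{1, v, w, vw}`; this is what makes the count of generating
pairs exact. -/
theorem mem_of_sqrtClass_mem_biquad {v w u : SquareClass K} (hv : v ≠ 1) (hw : w ≠ 1)
    (hvw : v * w ≠ 1) (hu : sqrtClass u ∈ biquad v w) :
    u = 1 ∨ u = v ∨ u = w ∨ u = v * w := by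
  have := isGalois_biquad v w
  obtain ⟨c, hc⟩ := (isBiquadratic_biquad hv hw hvw).exists_of_sq_mem (z := ⟨sqrtClass u, hu⟩)
    ⟨_, Subtype.ext (sqrtClass_sq u).symm⟩
  have hinj := (algebraMap K (AlgebraicClosure K)).injective
  rcases hc with hc | hc | hc | hc <;>
    have hc' : sqrtClass u ^ 2 = _ ^ 2 := congr(($hc : AlgebraicClosure K) ^ 2)
  · left
    rw [← out_eq u]
    refine mk_eq_one_of_sq (c := c) (hinj ?_)
    rw [← sqrtClass_sq, hc', map_pow]
    rfl
  · right; left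
    rw [← out_eq u, ← out_eq v]
    refine mk_eq_mk_of_sq (c := c) (hinj ?_)
    rw [← sqrtClass_sq, hc', map_mul, map_pow, ← sqrtClass_sq v, ← mul_pow]
    rfl
  · right; right; left
    rw [← out_eq u, ← out_eq w]
    refine mk_eq_mk_of_sq (c := c) (hinj ?_)
    rw [← sqrtClass_sq, hc', map_mul, map_pow, ← sqrtClass_sq w, ← mul_pow]
    rfl
  · right; right; right
    rw [← out_eq u, ← out_eq v, ← out_eq w, ← QuotientGroup.mk_mul]
    refine mk_eq_mk_of_sq (c := c) (hinj ?_)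
    rw [← sqrtClass_sq, hc', Units.val_mul, map_mul, map_mul, map_pow, ← sqrtClass_sq v,
      ← sqrtClass_sq w, ← mul_pow, ← mul_pow]
    rfl

theorem biquad_eq_of_mem {v w v' w' : SquareClass K} (hv : v ≠ 1) (hw : w ≠ 1)
    (hvw : v * w ≠ 1) (hv' : v' ≠ 1) (hw' : w' ≠ 1) (hvw' : v' * w' ≠ 1)
    (h : sqrtClass v' ∈ biquad v w) (h' : sqrtClass w' ∈ biquad v w) :
    biquad v' w' = biquad v w :=
  IntermediateField.eq_of_le_of_finrank_eq (biquad_le_iff.2 ⟨h, h'⟩)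
    (by rw [finrank_biquad hv hw hvw, finrank_biquad hv' hw' hvw'])

theorem exists_eq_biquad {L : IntermediateField K (AlgebraicClosure K)}
    (hL : Module.finrank K L = 4) (hG : HasGaloisClosureGroup L V4) :
    ∃ v w : SquareClass K, v ≠ 1 ∧ w ≠ 1 ∧ v * w ≠ 1 ∧ L = biquad v w := by
  have hfin : FiniteDimensional K L := Module.finite_of_finrank_pos (by omega)
  obtain ⟨e⟩ := hG
  have hgal : IsGalois K (normalClosure K L (AlgebraicClosure K)) := ⟨⟩
  have hcard : Module.finrank K (normalClosure K L (AlgebraicClosure K)) = 4 := by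
    rw [← IsGalois.card_aut_eq_finrank, Nat.card_congr e.toEquiv, IsKleinFour.card_four]
  -- The closure has degree `#V₄ = 4`, the degree of `L`, so `L` is already normal.
  have heq : L = normalClosure K L (AlgebraicClosure K) :=
    IntermediateField.eq_of_le_of_finrank_eq (IntermediateField.le_normalClosure L)
      (hL.trans hcard.symm)
  generalize normalClosure K L (AlgebraicClosure K) = M at *
  subst heq
  have : IsKleinFour Gal(L/K) := by
    refine ⟨by rw [Nat.card_congr e.toEquiv, IsKleinFour.card_four], ?_⟩
    rw [Monoid.exponent_eq_of_mulEquiv e, IsKleinFour.exponent_two]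
  obtain ⟨x, y, h⟩ := exists_isBiquadratic (K := K) (L := L)
  obtain ⟨a, ha⟩ := h.sq_left
  obtain ⟨b, hb⟩ := h.sq_right
  have ha0 : a ≠ 0 := by
    rintro rfl
    exact h.left_ne_zero (pow_eq_zero_iff two_ne_zero |>.1 (by rw [← ha, map_zero]))
  have hb0 : b ≠ 0 := by
    rintro rfl
    exact h.right_ne_zero (pow_eq_zero_iff two_ne_zero |>.1 (by rw [← hb, map_zero]))
  have key : ∀ (z : L) (c : Kˣ), z ^ 2 = algebraMap K L c → z ∉ (algebraMap K L).range →
      (c : SquareClass K) ≠ 1 := by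
    intro z c hz hz' hc
    obtain ⟨d, hd⟩ := exists_sq_mul_of_mk_eq_mk (b := 1) hc
    rw [hd, mul_one, Units.val_pow_eq_pow_val, map_pow] at hz
    rcases sq_eq_sq_iff_eq_or_eq_neg.1 hz with rfl | rfl
    · exact hz' ⟨_, rfl⟩
    · exact hz' (neg_mem ⟨_, rfl⟩)
  have h1 := key x (Units.mk0 a ha0) ha.symm h.left_notMem
  have h2 := key y (Units.mk0 b hb0) hb.symm h.right_notMem
  have h3 := key (x * y) (Units.mk0 a ha0 * Units.mk0 b hb0)
    (by rw [mul_pow, ← ha, ← hb, ← map_mul]; rfl) h.mul_notMem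
  refine ⟨_, _, h1, h2, h3, (IntermediateField.eq_of_le_of_finrank_eq (biquad_le_iff.2
    ⟨sqrtClass_mem (a := Units.mk0 a ha0) x.2 congr(($ha : AlgebraicClosure K)).symm,
      sqrtClass_mem (a := Units.mk0 b hb0) y.2 congr(($hb : AlgebraicClosure K)).symm⟩) ?_).symm⟩
  rw [hL]
  exact finrank_biquad h1 h2 h3

end BiquadraticFields

/-! ### Totally ramified extensions: integral power basis, discriminant, residue criterion. -/

section Ramification

variable {K L : Type*} [Field K] [Algebra ℚ_[2] K] [FiniteDimensional ℚ_[2] K]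
    [Algebra ℤ_[2] K] [IsScalarTower ℤ_[2] ℚ_[2] K]
    [Field L] [Algebra ℚ_[2] L] [FiniteDimensional ℚ_[2] L]
    [Algebra ℤ_[2] L] [IsScalarTower ℤ_[2] ℚ_[2] L]
    [Algebra K L] [IsScalarTower ℤ_[2] K L] [IsScalarTower ℚ_[2] K L]

theorem coe_integersMap (x : Integers K) : (integersMap K L x : L) = algebraMap K L x := rfl

theorem absv_integersMap (x : Integers K) : absv L (integersMap K L x : L) = absv K x :=
  absv_algebraMap (x : K)

variable (K L) in
theorem exists_rho_eq_pow : ∃ n : ℕ, 0 < n ∧ rho K = rho L ^ n := by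
  obtain ⟨n, hn⟩ := exists_absv_eq (K := L) (c := algebraMap K L (unif K))
    ((map_ne_zero _).2 unif_ne_zero)
  rw [absv_algebraMap, absv_unif] at hn
  have h0 : 0 < n := by
    rw [← rho_zpow_lt (K := L), ← hn, zpow_zero]
    exact rho_lt_one K
  obtain ⟨m, rfl⟩ := Int.eq_ofNat_of_zero_le h0.le
  exact ⟨m, by exact_mod_cast h0, by rw [hn, zpow_natCast]⟩

theorem ramificationIdx_eq {n : ℕ} (h : rho K = rho L ^ n) :
    letI := (integersMap K L).toAlgebra
    (maxIdeal L).ramificationIdx (Integers K) = n := by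
  let := (integersMap K L).toAlgebra
  have hu : (maxIdeal L).under (Integers K) = maxIdeal K := by
    ext x
    rw [Ideal.mem_comap, mem_maxIdeal_iff, mem_maxIdeal_iff]
    exact Iff.of_eq (congrArg (· < 1) (absv_integersMap x))
  have hm : ((maxIdeal L).under (Integers K)).map (algebraMap (Integers K) (Integers L)) =
      maxIdeal L ^ n := by
    rw [hu, maxIdeal_eq_span, Ideal.map_span, Set.image_singleton]
    exact span_eq_maxIdeal_pow ((absv_integersMap _).trans h)
  rw [Ideal.IsDedekindDomain.ramificationIdx_eq_multiplicity
    ((maxIdeal L).under (Integers K)) (maxIdeal L), hm, multiplicity_maxIdeal_pow]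
  rw [hm]
  exact pow_ne_zero n maxIdeal_ne_bot

theorem isTotallyRamified_iff :
    IsTotallyRamified K L ↔ rho K = rho L ^ Module.finrank K L := by
  obtain ⟨n, -, hn⟩ := exists_rho_eq_pow K L
  rw [IsTotallyRamified, ramificationIdx_eq hn, hn, ← zpow_natCast, ← zpow_natCast, rho_zpow_inj]
  norm_cast

/-- The nonzero terms have valuations in distinct classes modulo `n`, so the largest one is not
cancelled. -/
theorem absv_term_le_absv_sum {n : ℕ} (h : rho K = rho L ^ n) (c : Fin n → K) (i : Fin n) :
    absv L (algebraMap K L (c i) * unif L ^ (i : ℕ)) ≤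
      absv L (∑ j, algebraMap K L (c j) * unif L ^ (j : ℕ)) := by
  obtain ⟨k, -, hk⟩ := Finset.exists_max_image Finset.univ
    (fun j ↦ absv L (algebraMap K L (c j) * unif L ^ (j : ℕ))) ⟨i, Finset.mem_univ i⟩
  refine (hk i (Finset.mem_univ i)).trans ?_
  rcases eq_or_ne (c k) 0 with hck | hck
  · rw [hck, map_zero, zero_mul, map_zero]
    exact (absv L).nonneg _
  have hform : ∀ l, c l ≠ 0 → ∃ m : ℤ,
      absv L (algebraMap K L (c l) * unif L ^ (l : ℕ)) = rho L ^ (n * m + l) := by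
    intro l hl
    obtain ⟨m, hm⟩ := exists_absv_eq hl
    refine ⟨m, ?_⟩
    rw [map_mul, absv_algebraMap, hm, map_pow, absv_unif, h, zpow_add₀ (rho_pos L).ne', zpow_mul,
      zpow_natCast, zpow_natCast]
  suffices hlt : ∀ j ∈ Finset.univ, j ≠ k →
      absv L (algebraMap K L (c j) * unif L ^ (j : ℕ)) <
        absv L (algebraMap K L (c k) * unif L ^ (k : ℕ)) from
    (IsNonarchimedean.apply_sum_eq_of_lt (f := absv L) absv_isNonarchimedean
      (fun a ↦ ((absv L).map_neg a).symm) (Finset.mem_univ k) hlt).ge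
  intro j _ hj
  refine lt_of_le_of_ne (hk j (Finset.mem_univ j)) fun heq ↦ hj ?_
  have hcj : c j ≠ 0 := by
    intro hcj
    rw [hcj, map_zero, zero_mul, map_zero, eq_comm, (absv L).eq_zero] at heq
    exact mul_ne_zero ((map_ne_zero _).2 hck) (pow_ne_zero _ unif_ne_zero) heq
  obtain ⟨a, ha⟩ := hform j hcj
  obtain ⟨b, hb⟩ := hform k hck
  rw [ha, hb, rho_zpow_inj] at heq
  have h1 := j.2
  have h2 := k.2
  have h3 := congrArg (· % (n : ℤ)) heq
  simp only [Int.mul_add_emod_self_left] at h3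
  rw [Int.emod_eq_of_lt (by omega) (by omega), Int.emod_eq_of_lt (by omega) (by omega)] at h3
  exact Fin.ext (by omega)

/-- If `c i` has valuation `m`, its term has valuation `n m + i ≥ 0` with `i < n`, which forces `m ≥
0`. In the totally ramified case this makes the powers of the uniformizer an integral basis. -/
theorem absv_coeff_le_one {n : ℕ} (h : rho K = rho L ^ n) {c : Fin n → K}
    (hc : absv L (∑ j, algebraMap K L (c j) * unif L ^ (j : ℕ)) ≤ 1) (i : Fin n) :
    absv K (c i) ≤ 1 := by
  have h1 := (absv_term_le_absv_sum h c i).trans hc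
  rcases eq_or_ne (c i) 0 with hci | hci
  · simp [hci]
  obtain ⟨m, hm⟩ := exists_absv_eq hci
  rw [map_mul, absv_algebraMap, hm, map_pow, absv_unif, h, ← zpow_natCast, ← zpow_natCast,
    ← zpow_mul, ← zpow_add₀ (rho_pos L).ne', ← zpow_zero (rho L), rho_zpow_le] at h1
  rw [hm, ← zpow_zero (rho K), rho_zpow_le]
  by_contra! hm0
  have := i.2
  nlinarith

theorem linearIndependent_unif_pow {n : ℕ} (h : rho K = rho L ^ n) :
    LinearIndependent K (fun i : Fin n ↦ unif L ^ (i : ℕ)) := by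
  rw [Fintype.linearIndependent_iff]
  intro c hc i
  simp only [Algebra.smul_def] at hc
  have := absv_term_le_absv_sum h c i
  rw [hc, map_zero] at this
  have h0 := (absv L).eq_zero.1 (le_antisymm this ((absv L).nonneg _))
  exact (map_eq_zero _).1 ((mul_eq_zero.1 h0).resolve_right (pow_ne_zero _ unif_ne_zero))

variable [FiniteDimensional K L]

/-- The powers of a uniformizer of a totally ramified extension form a power basis. -/
def unifPowerBasis (h : rho K = rho L ^ Module.finrank K L) : PowerBasis K L where
  gen := unif L
  dim := Module.finrank K L
  basis := haveI : Nonempty (Fin (Module.finrank K L)) := ⟨⟨0, Module.finrank_pos⟩⟩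
    basisOfLinearIndependentOfCardEqFinrank (linearIndependent_unif_pow h) (by simp)
  basis_eq_pow i := by simp

theorem exists_coeff_of_mem_integers (h : rho K = rho L ^ Module.finrank K L) {z : L}
    (hz : absv L z ≤ 1) : ∃ c : Fin (Module.finrank K L) → K, (∀ i, absv K (c i) ≤ 1) ∧
      z = ∑ j, algebraMap K L (c j) * unif L ^ (j : ℕ) := by
  have hsum := (unifPowerBasis h).basis.sum_repr z
  simp only [PowerBasis.coe_basis, Algebra.smul_def] at hsum
  change (∑ j : Fin (Module.finrank K L),
    algebraMap K L ((unifPowerBasis h).basis.repr z j) * unif L ^ (j : ℕ)) = z at hsum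
  exact ⟨_, absv_coeff_le_one h (by rwa [hsum]), hsum.symm⟩

-- Any basis of integral elements is an integral matrix times the power basis, and its discriminant
-- changes by the square of the determinant.
open Matrix in
theorem discrIdeal_eq_span (h : rho K = rho L ^ Module.finrank K L) :
    ∃ d : Integers K, (d : K) = Algebra.discr K (unifPowerBasis h).basis ∧
      discrIdeal K L = Ideal.span {d} := by
  have hint : ∀ i, (unifPowerBasis h).basis i ∈ Integers L := fun i ↦ by
    rw [PowerBasis.coe_basis, mem_integers_iff_absv, map_pow]
    exact pow_le_one₀ ((absv L).nonneg _) (rho_lt_one L).le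
  have hd : Algebra.discr K (unifPowerBasis h).basis ∈ Integers K :=
    Algebra.discr_isIntegral K hint
  refine ⟨⟨_, hd⟩, rfl, le_antisymm ?_ ?_⟩
  · rw [discrIdeal, Ideal.span_le]
    rintro d ⟨b, hb, hbd⟩
    set P := (unifPowerBasis h).basis.toMatrix b with hP
    have hb' : (unifPowerBasis h).basis ᵥ* P.map (algebraMap K L) = b :=
      Module.Basis.toMatrix_map_vecMul _ _
    have hdet := Algebra.discr_of_matrix_vecMul (A := K) (unifPowerBasis h).basis P
    replace hdet := hbd.trans ((congrArg (Algebra.discr K) hb').symm.trans hdet)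
    have hPint : P.det ∈ Integers K := IsIntegral.det fun i j ↦ by
      have hs := (unifPowerBasis h).basis.sum_repr (b j)
      simp only [PowerBasis.coe_basis, Algebra.smul_def] at hs
      refine (mem_integers_iff_absv _).2 (absv_coeff_le_one (L := L) h
        (c := fun i ↦ (unifPowerBasis h).basis.repr (b j) i) ?_ i)
      refine le_of_eq_of_le (congrArg (absv L) hs) ((mem_integers_iff_absv _).1 (hb j))
    refine Ideal.mem_span_singleton.2 ⟨⟨P.det, hPint⟩ ^ 2, Subtype.ext ?_⟩
    rw [hdet, mul_comm]
    rfl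
  · rw [Ideal.span_singleton_le_iff_mem]
    exact Ideal.subset_span ⟨(unifPowerBasis h).basis, hint, rfl⟩

theorem discrVal_eq_of_absv (h : rho K = rho L ^ Module.finrank K L) {n : ℕ}
    (hn : absv K (Algebra.discr K (unifPowerBasis h).basis) = rho K ^ n) :
    discrVal K L = n := by
  obtain ⟨d, hd, hd'⟩ := discrIdeal_eq_span h
  rw [← hd] at hn
  rw [discrVal, hd', span_eq_maxIdeal_pow hn, multiplicity_maxIdeal_pow]

open Classical Polynomial in
theorem aeval_derivative_minpoly_gen [IsGalois K L] (pb : PowerBasis K L) :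
    aeval pb.gen (derivative (minpoly K pb.gen)) =
      ∏ σ ∈ Finset.univ.erase (1 : Gal(L/K)), (pb.gen - σ pb.gen) := by
  have hinj : Function.Injective fun σ : Gal(L/K) ↦ σ pb.gen := fun σ τ h ↦ by
    have : (σ : L →ₐ[K] L) = τ := pb.algHom_ext h
    exact AlgEquiv.ext fun z ↦ DFunLike.congr_fun this z
  have hmonic : (∏ σ : Gal(L/K), (X - C (σ pb.gen))).Monic :=
    monic_prod_of_monic _ _ fun σ _ ↦ monic_X_sub_C _
  have heq : ∏ σ : Gal(L/K), (X - C (σ pb.gen)) = (minpoly K pb.gen).map (algebraMap K L) := by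
    refine (eq_of_monic_of_dvd_of_natDegree_le hmonic ((minpoly.monic pb.isIntegral_gen).map _)
      ?_ ?_).symm
    · refine Finset.prod_dvd_of_coprime
        ((pairwise_coprime_X_sub_C hinj).set_pairwise _) fun σ _ ↦ ?_
      rw [dvd_iff_isRoot, IsRoot.def, eval_map_algebraMap, aeval_algHom_apply σ]
      simp
    · rw [natDegree_map, pb.natDegree_minpoly, natDegree_prod_of_monic _ _
        fun σ _ ↦ monic_X_sub_C _]
      simp only [natDegree_X_sub_C, Finset.sum_const, Finset.card_univ, smul_eq_mul, mul_one]
      rw [← pb.finrank, ← IsGalois.card_aut_eq_finrank, Nat.card_eq_fintype_card]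
  rw [← eval_map_algebraMap, ← derivative_map, ← heq,
    ← Finset.mul_prod_erase _ _ (Finset.mem_univ (1 : Gal(L/K))), derivative_mul]
  simp [eval_prod]

-- The discriminant of a power basis is, up to sign, the norm of `f'(ϖ)`, which is the product of
-- the differences `ϖ - σϖ`. The norm raises absolute values to the power `[L : K]`, as conjugates
-- have equal absolute value.
open Classical in
theorem absv_discr [IsGalois K L] (h : rho K = rho L ^ Module.finrank K L) :
    absv K (Algebra.discr K (unifPowerBasis h).basis) =
      (∏ σ ∈ Finset.univ.erase (1 : Gal(L/K)), absv L (unif L - σ (unif L))) ^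
        Module.finrank K L := by
  have hnorm : ∀ z : L, absv K (Algebra.norm K z) = absv L z ^ Module.finrank K L := fun z ↦ by
    rw [← absv_algebraMap (L := L), Algebra.norm_eq_prod_automorphisms, map_prod]
    simp only [absv_algEquiv, Finset.prod_const, Finset.card_univ]
    rw [← IsGalois.card_aut_eq_finrank, Nat.card_eq_fintype_card]
  rw [Algebra.discr_powerBasis_eq_norm, map_mul, map_pow, (absv K).map_neg, map_one, one_pow,
    one_mul, hnorm, aeval_derivative_minpoly_gen, map_prod]
  rfl

/-- Let `n` be the ramification index. Independence of `1, ϖ, …, ϖ ^ (n-1)` gives `n ≤ [L : K]`.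
With no residue extension, digit expansion and Nakayama show that these powers generate `𝒪_L` over
`𝒪_K`, giving the reverse inequality. -/
theorem isTotallyRamified_of_residue
    (hres : ∀ z : L, absv L z ≤ 1 → ∃ c : K, absv L (z - algebraMap K L c) < 1) :
    IsTotallyRamified K L := by
  obtain ⟨n, hn0, hn⟩ := exists_rho_eq_pow K L
  rw [isTotallyRamified_iff, hn]
  congr 1
  refine le_antisymm ?_ ?_
  · simpa using (linearIndependent_unif_pow hn).fintype_card_le_finrank
  let := (integersMap K L).toAlgebra
  have htower : IsScalarTower ℤ_[2] (Integers K) (Integers L) := IsScalarTower.of_algebraMap_eq'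
    (RingHom.ext fun x ↦ Subtype.ext (IsScalarTower.algebraMap_apply ℤ_[2] K L x))
  have hfin : Module.Finite (Integers K) (Integers L) :=
    Module.Finite.of_restrictScalars_finite ℤ_[2] _ _
  have hsmul : ∀ (c : Integers K) (z : Integers L),
      ((c • z : Integers L) : L) = algebraMap K L c * z := fun c z ↦ rfl
  set N : Submodule (Integers K) (Integers L) :=
    Submodule.span _ (Set.range fun i : Fin n ↦ unifInt L ^ (i : ℕ)) with hN
  -- Expansion to `m` digits in powers of the uniformizer of `L`, all digits taken in `𝒪_K`.
  have hstep : ∀ m ≤ n, ∀ z : Integers L, ∃ w : Integers L, ∃ u ∈ N,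
      z = u + unifInt L ^ m * w := by
    intro m
    induction m with
    | zero => exact fun _ z ↦ ⟨z, 0, zero_mem _, by simp⟩
    | succ m ih =>
      intro hm z
      obtain ⟨w, u, hu, hz⟩ := ih (by omega) z
      obtain ⟨c, hc⟩ := hres w ((mem_integers_iff_absv _).1 w.2)
      have hcint : absv K c ≤ 1 := by
        rw [← absv_algebraMap (L := L)]
        have := absv_sub_le (w : L) (w - algebraMap K L c)
        rw [sub_sub_cancel] at this
        exact this.trans (max_le ((mem_integers_iff_absv _).1 w.2) hc.le)
      have hmem : w - (⟨c, (mem_integers_iff_absv _).2 hcint⟩ : Integers K) • (1 : Integers L) ∈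
          maxIdeal L := by
        rw [mem_maxIdeal_iff, Subalgebra.coe_sub, hsmul, Subalgebra.coe_one, mul_one]
        exact hc
      rw [maxIdeal_eq_span, Ideal.mem_span_singleton] at hmem
      obtain ⟨w', hw'⟩ := hmem
      refine ⟨w', u + (⟨c, (mem_integers_iff_absv _).2 hcint⟩ : Integers K) • unifInt L ^ m,
        add_mem hu (N.smul_mem _ (Submodule.subset_span ⟨⟨m, by omega⟩, rfl⟩)), ?_⟩
      rw [hz, pow_succ, mul_assoc, ← hw', mul_sub, mul_smul_comm, mul_one]
      abel
  have htop : (⊤ : Submodule (Integers K) (Integers L)) ≤ N := by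
    refine Submodule.le_of_le_smul_of_le_jacobson_bot (I := maxIdeal K) hfin.fg_top
      (IsLocalRing.maximalIdeal_le_jacobson _) fun z _ ↦ ?_
    obtain ⟨w, u, hu, rfl⟩ := hstep n le_rfl z
    refine Submodule.add_mem_sup hu ?_
    -- After `n` digits the remainder is divisible by the uniformizer of `K`, as Nakayama requires.
    have hle : absv L ((unifInt L ^ n * w : Integers L) : L) ≤
        absv L (integersMap K L (unifInt K) : L) := by
      rw [absv_integersMap, Subalgebra.coe_mul, map_mul, Subalgebra.coe_pow, map_pow]
      exact (mul_le_of_le_one_right (pow_nonneg ((absv L).nonneg _) _)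
        ((mem_integers_iff_absv _).1 w.2)).trans hn.ge
    rw [← mem_span_iff_absv_le, Ideal.mem_span_singleton] at hle
    obtain ⟨w', hw'⟩ := hle
    rw [hw']
    refine Submodule.smul_mem_smul (r := unifInt K) (n := w') ?_ trivial
    rw [maxIdeal_eq_span]
    exact Ideal.mem_span_singleton_self _
  have hspan : ∀ z : Integers L,
      (z : L) ∈ Submodule.span K (Set.range fun i : Fin n ↦ unif L ^ (i : ℕ)) := by
    intro z
    have hz : z ∈ N := htop trivial
    induction hz using Submodule.span_induction with
    | mem z hz =>
      obtain ⟨i, rfl⟩ := hz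
      exact Submodule.subset_span ⟨i, rfl⟩
    | zero => exact zero_mem _
    | add z w _ _ hz hw => exact add_mem hz hw
    | smul c z _ hz =>
      rw [hsmul, ← Algebra.smul_def]
      exact Submodule.smul_mem _ _ hz
  have hall : Submodule.span K (Set.range fun i : Fin n ↦ unif L ^ (i : ℕ)) = ⊤ := by
    refine Submodule.eq_top_iff'.2 fun z ↦ ?_
    -- A large power of the uniformizer of `K` makes `z` integral.
    obtain ⟨m, hm⟩ := exists_pow_lt_of_lt_one (y := rho K) (x := (1 + absv L z)⁻¹)
      (inv_pos.2 (by positivity)) (rho_lt_one K)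
    have hint : absv L (algebraMap K L (unif K ^ m) * z) ≤ 1 := by
      rw [map_mul, absv_algebraMap, map_pow, absv_unif]
      have h1 : 0 < 1 + absv L z := by positivity
      calc rho K ^ m * absv L z ≤ (1 + absv L z)⁻¹ * (1 + absv L z) :=
            mul_le_mul hm.le (by linarith) ((absv L).nonneg _) (inv_pos.2 h1).le
        _ = 1 := inv_mul_cancel₀ h1.ne'
    have h2 := Submodule.smul_mem _ (unif K ^ m)⁻¹ (hspan ⟨_, (mem_integers_iff_absv _).2 hint⟩)
    rwa [Algebra.smul_def, ← mul_assoc, ← map_mul, inv_mul_cancel₀ (pow_ne_zero _ unif_ne_zero),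
      map_one, one_mul] at h2
  rw [← finrank_top, ← hall]
  exact (finrank_range_le_card _).trans (by simp)

end Ramification

/-! ### Comparison of ramification in `L` and in its quadratic subfields. -/

section QuadraticSubfields

variable {K L : Type*} [Field K] [Algebra ℚ_[2] K] [FiniteDimensional ℚ_[2] K]
    [Algebra ℤ_[2] K] [IsScalarTower ℤ_[2] ℚ_[2] K]
    [Field L] [Algebra ℚ_[2] L] [FiniteDimensional ℚ_[2] L]
    [Algebra ℤ_[2] L] [IsScalarTower ℤ_[2] ℚ_[2] L]
    [Algebra K L] [IsScalarTower ℤ_[2] K L] [IsScalarTower ℚ_[2] K L]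

/-- If `a` is a ramified square class, then `K(√a)` has a uniformizer of the form `(√a - c) / r`
with `c, r ∈ K`, and its conjugates differ by an element of valuation determined by
`discExp a`. -/
theorem exists_quadratic_uniformizer {a : Kˣ} (ha : (a : SquareClass K) ∉ classFiltration K 0)
    {y : L} (hy : y ^ 2 = algebraMap K L a) : ∃ c r : K, r ≠ 0 ∧
      absv L ((y - algebraMap K L c) / algebraMap K L r) ^ 2 = rho K ∧
      absv L (2 * y / algebraMap K L r) ^ 2 = rho K ^ discExp K (a : SquareClass K) := by
  have hρ := rho_pos K
  have h2 : absv L 2 = rho K ^ absRamificationIdx K := by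
    rw [← absv_two, ← absv_algebraMap (F := K) (L := L), map_ofNat (algebraMap K L)]
  have hy2 : absv L y ^ 2 = absv K a := by rw [← map_pow, hy, absv_algebraMap]
  by_cases he : (a : SquareClass K) ∈ classFiltration K (absRamificationIdx K)
  · obtain ⟨m, hm, h1, h0⟩ := exists_level he ha
    rw [discExp_of_mem hm h1 h0]
    rw [mk_mem_classFiltration] at h1 h0
    obtain ⟨j, hj⟩ : ∃ j, j = absRamificationIdx K - (m + 1) := ⟨_, rfl⟩
    rw [← hj, sup_squares_even_eq (by omega), mem_sup_squares] at h1
    rw [show absRamificationIdx K - m = j + 1 by omega, mem_sup_squares] at h0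
    obtain ⟨s, hs, hs'⟩ := h1
    have hs0 : algebraMap K L s ≠ 0 := (map_ne_zero _).2 s.ne_zero
    -- The level is exact: one order better would place the class in the smaller step of the
    -- filtration.
    have hlev : absv K (((a / s ^ 2 : Kˣ) : K) - 1) = rho K ^ (2 * j + 1) := by
      refine le_antisymm hs' (le_of_not_gt fun hlt ↦ h0 ⟨s, hs, ?_⟩)
      rw [← zpow_natCast (rho K), lt_rho_zpow_iff] at hlt
      exact_mod_cast hlt
    have hy' : (y / algebraMap K L s) ^ 2 = algebraMap K L ((a / s ^ 2 : Kˣ) : K) := by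
      rw [div_pow, hy, Units.val_div_eq_div_val, Units.val_pow_eq_pow_val, map_div₀, map_pow]
    have hsq : absv L (y / algebraMap K L s - 1) ^ 2 = rho K ^ (2 * j + 1) := by
      have hlev' : absv L ((y / algebraMap K L s) ^ 2 - 1) = rho K ^ (2 * j + 1) := by
        rw [hy', ← hlev, ← absv_algebraMap (F := K) (L := L),
          map_sub (algebraMap K L), map_one (algebraMap K L)]
      rcases absv_sq_sub_one (y / algebraMap K L s) with ⟨-, h⟩ | ⟨-, h⟩
      · exfalso
        rw [hlev', show (4 : L) = 2 ^ 2 by norm_num, map_pow, h2, ← pow_mul, ← zpow_natCast,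
          ← zpow_natCast, rho_zpow_le] at h
        push_cast at h
        omega
      · rw [← h, hlev']
    -- Since `|√a / s - 1|² = ρ ^ (2j + 1)`, dividing by `π ^ j` leaves a uniformizer. Its
    -- conjugates differ by `2√a / (s π ^ j)`, with square of size `ρ ^ (2(e - j)) = ρ ^ (2(m +
    -- 1))`.
    refine ⟨s, s * unif K ^ j, mul_ne_zero s.ne_zero (pow_ne_zero _ unif_ne_zero), ?_, ?_⟩
    · have : (y - algebraMap K L s) / algebraMap K L (s * unif K ^ j) =
          (y / algebraMap K L s - 1) / algebraMap K L (unif K ^ j) := by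
        rw [map_mul, div_sub_one hs0, div_div]
      rw [this, map_div₀, div_pow, hsq, absv_algebraMap, map_pow, absv_unif, pow_succ, mul_comm 2,
        pow_mul, mul_div_cancel_left₀ _ (by positivity)]
    · have hy1 : absv L (y / algebraMap K L s) ^ 2 = 1 := by
        rw [← map_pow, hy', absv_algebraMap, hs]
      have : 2 * y / algebraMap K L (s * unif K ^ j) =
          2 * (y / algebraMap K L s) / algebraMap K L (unif K ^ j) := by
        rw [map_mul, mul_div_assoc, mul_div_assoc, div_div]
      rw [this, map_div₀, map_mul, div_pow, mul_pow, hy1, mul_one, h2, absv_algebraMap, map_pow,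
        absv_unif, ← pow_mul, ← pow_mul, div_eq_iff (by positivity), ← pow_add]
      congr 1
      omega
  · rw [discExp_of_notMem he]
    rw [mk_mem_classFiltration, Nat.sub_self, mul_zero, mem_sup_squares_zero] at he
    obtain ⟨n, hn⟩ := exists_absv_eq a.ne_zero
    obtain ⟨k, hk | hk⟩ := Int.even_or_odd' n
    · exact absurd ⟨k, hk ▸ hn⟩ he
    have key : absv L (y / algebraMap K L (unif K ^ k)) ^ 2 = rho K := by
      rw [map_div₀, div_pow, hy2, hn, absv_algebraMap, map_zpow₀, absv_unif, ← zpow_natCast,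
        ← zpow_mul, hk, div_eq_iff (zpow_pos hρ _).ne', ← zpow_one_add₀ hρ.ne']
      congr 1
      push_cast
      ring
    -- For `a` of odd valuation `2k + 1`, the element `√a / π ^ k` is itself a uniformizer.
    refine ⟨0, unif K ^ k, zpow_ne_zero _ unif_ne_zero, by rwa [map_zero, sub_zero], ?_⟩
    rw [mul_div_assoc, map_mul, mul_pow, key, h2, pow_succ (rho K), ← pow_mul, mul_comm 2]

/-- For nonzero `A` and `B`, `|A|²` is an even power of `ρ_K` and `|Bu|²` an odd one, so the two
terms cannot cancel. -/
theorem absv_mul_le_of_sq_eq_rho {u : L} (hu : absv L u ^ 2 = rho K) (A B : K) :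
    absv L (algebraMap K L B * u) ≤ absv L (algebraMap K L A + algebraMap K L B * u) := by
  rcases eq_or_ne B 0 with rfl | hB
  · simp
  rcases lt_trichotomy (absv L (algebraMap K L A)) (absv L (algebraMap K L B * u)) with h | h | h
  · exact (absv_add_of_lt h).ge
  · exfalso
    have hu0 : u ≠ 0 := by
      rintro rfl
      rw [map_zero, zero_pow two_ne_zero] at hu
      exact (rho_pos K).ne hu
    have hA : A ≠ 0 := by
      rintro rfl
      rw [map_zero, map_zero, eq_comm, (absv L).eq_zero] at h
      exact mul_ne_zero ((map_ne_zero _).2 hB) hu0 h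
    obtain ⟨m, hm⟩ := exists_absv_eq hA
    obtain ⟨n, hn⟩ := exists_absv_eq hB
    have h2 := congrArg (· ^ 2) h
    simp only [map_mul, absv_algebraMap, mul_pow, hm, hn, hu] at h2
    rw [← zpow_natCast, ← zpow_natCast, ← zpow_mul, ← zpow_mul, ← zpow_add_one₀ (rho_pos K).ne',
      rho_zpow_inj] at h2
    push_cast at h2
    omega
  · rw [add_comm, absv_add_of_lt h]
    exact h.le

theorem absv_le_one_of_sq_eq_rho {u : L} (hu : absv L u ^ 2 = rho K) {B : K}
    (h : absv L (algebraMap K L B * u) ≤ 1) : absv K B ≤ 1 := by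
  rcases eq_or_ne B 0 with rfl | hB
  · simp
  obtain ⟨n, hn⟩ := exists_absv_eq hB
  have h2 := pow_le_one₀ ((absv L).nonneg _) h (n := 2)
  rw [map_mul, absv_algebraMap, mul_pow, hu, hn, ← zpow_natCast, ← zpow_mul,
    ← zpow_add_one₀ (rho_pos K).ne', ← zpow_zero (rho K), rho_zpow_le] at h2
  rw [hn, ← zpow_zero (rho K), rho_zpow_le]
  push_cast at h2
  omega

/-- The action of commuting involutions `σ` and `τ` of `L / K` with common fixed field `K`. -/
structure IsInvolutionPair (σ τ : Gal(L/K)) : Prop where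
  left : ∀ z, σ (σ z) = z
  right : ∀ z, τ (τ z) = z
  comm : ∀ z, σ (τ z) = τ (σ z)
  mem_range : ∀ z, τ z = z → σ z = z → z ∈ (algebraMap K L).range

theorem IsInvolutionPair.exists_eq_add_mul {σ τ : Gal(L/K)} (h : IsInvolutionPair σ τ) {y : L}
    (hσ : σ y = -y) (hτ : τ y = y) (hy : y ≠ 0) {z : L} (hz : τ z = z) :
    ∃ A B : K, z = algebraMap K L A + algebraMap K L B * y := by
  have h2 : (2 : L) ≠ 0 := two_ne_zero'
  obtain ⟨A, hA⟩ := h.mem_range ((z + σ z) / 2)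
    (by rw [map_div₀, map_add, ← h.comm, hz, map_ofNat])
    (by rw [map_div₀, map_add, h.left, map_ofNat, add_comm])
  obtain ⟨B, hB⟩ := h.mem_range ((z - σ z) / (2 * y))
    (by rw [map_div₀, map_sub, ← h.comm, hz, map_mul, map_ofNat, hτ])
    (by rw [map_div₀, map_sub, h.left, map_mul, map_ofNat, hσ, mul_neg, div_neg, ← neg_div,
      neg_sub])
  refine ⟨A, B, ?_⟩
  rw [hA, hB]
  field_simp
  ring

/-- An integer of `K(y)` is `A + B u` with `u = (y - c) / r` and `B` integral, so `σ` displaces it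
no more than it displaces `u`. -/
theorem IsInvolutionPair.absv_sub_le {σ τ : Gal(L/K)} (h : IsInvolutionPair σ τ) {y : L}
    (hσ : σ y = -y) (hτ : τ y = y) (hy : y ≠ 0) {c r : K} (hr : r ≠ 0)
    (hu : absv L ((y - algebraMap K L c) / algebraMap K L r) ^ 2 = rho K)
    {z : L} (hz : τ z = z) (hz1 : absv L z ≤ 1) :
    absv L (σ z - z) ≤ absv L (2 * y / algebraMap K L r) := by
  obtain ⟨A, B, hAB⟩ := h.exists_eq_add_mul hσ hτ hy hz
  have hr' : algebraMap K L r ≠ 0 := (map_ne_zero _).2 hr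
  have hz' : z = algebraMap K L (A + B * c) +
      algebraMap K L (B * r) * ((y - algebraMap K L c) / algebraMap K L r) := by
    rw [hAB, map_add, map_mul, map_mul]
    field_simp
    ring
  have h1 := absv_mul_le_of_sq_eq_rho hu (A + B * c) (B * r)
  rw [← hz'] at h1
  have h2 := absv_le_one_of_sq_eq_rho hu (h1.trans hz1)
  have h3 : σ z - z = -(algebraMap K L (B * r) * (2 * y / algebraMap K L r)) := by
    rw [hAB, map_add, map_mul, σ.commutes, σ.commutes, hσ, map_mul]
    field_simp
    ring
  rw [h3, (absv L).map_neg, map_mul, absv_algebraMap]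
  exact mul_le_of_le_one_left ((absv L).nonneg _) h2

open Polynomial in
theorem exists_eval_eq_mul {R : Type*} [CommRing R] [IsDomain R] (p : R[X]) {a b : R}
    (hab : a ≠ b) (ha : p.eval a = 0) (hb : p.eval b = 0) (c : R) :
    ∃ d, p.eval c = (c - a) * (c - b) * d := by
  obtain ⟨f, rfl⟩ := dvd_iff_isRoot.2 ha
  rw [eval_mul, eval_sub, eval_X, eval_C] at hb
  obtain ⟨g, rfl⟩ := dvd_iff_isRoot.2
    ((mul_eq_zero.1 hb).resolve_left (sub_ne_zero.2 hab.symm))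
  exact ⟨g.eval c, by simp [mul_assoc]⟩

variable [FiniteDimensional K L]

/-- Write `u = g(ϖ)` with `g` integral over `K`. As `στ u = σ u`, the polynomial `g - σ u` vanishes
at `σϖ` and `στϖ`, hence is divisible by `(X - σϖ)(X - στϖ)` over `𝒪_L`; evaluate at `ϖ`. -/
theorem absv_apply_sub_le_mul {σ τ : Gal(L/K)}
    (htot : rho K = rho L ^ Module.finrank K L) (hτ : τ (unif L) ≠ unif L) {u : L}
    (hu : absv L u ≤ 1) (hτu : τ u = u) :
    absv L (σ u - u) ≤ absv L (unif L - σ (unif L)) * absv L (unif L - σ (τ (unif L))) := by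
  obtain ⟨c, hc, hsum⟩ := exists_coeff_of_mem_integers htot hu
  have hint : ∀ (ρ : Gal(L/K)) (z : L), absv L z ≤ 1 → ρ z ∈ Integers L := fun ρ z hz ↦
    (mem_integers_iff_absv _).2 (by rwa [absv_algEquiv])
  have hϖ : absv L (unif L) ≤ 1 := (rho_lt_one L).le
  set p : Polynomial (Integers L) := ∑ j, Polynomial.C (integersMap K L
    ⟨c j, (mem_integers_iff_absv _).2 (hc j)⟩) * Polynomial.X ^ (j : ℕ) -
      Polynomial.C ⟨σ u, hint σ u hu⟩ with hp
  have heval : ∀ z : Integers L,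
      ((p.eval z : Integers L) : L) = (∑ j, algebraMap K L (c j) * (z : L) ^ (j : ℕ)) - σ u := by
    intro z
    rw [hp, Polynomial.eval_sub, Polynomial.eval_finsetSum, Polynomial.eval_C,
      Subalgebra.coe_sub, AddSubmonoidClass.coe_finsetSum]
    simp [coe_integersMap]
  have hroot : ∀ (ρ : Gal(L/K)) (hρ : ρ u = σ u),
      p.eval ⟨ρ (unif L), hint ρ _ hϖ⟩ = 0 := by
    intro ρ hρ
    refine Subtype.ext ?_
    rw [heval, ← hρ]
    have hρu := congrArg ρ hsum
    rw [map_sum] at hρu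
    rw [hρu]
    simp
  obtain ⟨d, hd⟩ := exists_eval_eq_mul p (a := ⟨σ (unif L), hint σ _ hϖ⟩)
    (b := ⟨(σ * τ) (unif L), hint (σ * τ) _ hϖ⟩)
    (fun hab ↦ hτ (σ.injective (congrArg Subtype.val hab)).symm)
    (hroot σ rfl) (hroot (σ * τ) (by rw [AlgEquiv.mul_apply, hτu])) (unifInt L)
  have hd' := congrArg (fun z : Integers L ↦ absv L (z : L)) hd
  simp only [heval] at hd'
  have h1 : (∑ j, algebraMap K L (c j) * ((unifInt L : Integers L) : L) ^ (j : ℕ)) = u := hsum.symm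
  rw [h1, Subalgebra.coe_mul, Subalgebra.coe_mul, map_mul, map_mul] at hd'
  rw [← (absv L).map_neg, neg_sub, hd']
  exact mul_le_of_le_one_right (mul_nonneg ((absv L).nonneg _) ((absv L).nonneg _))
    ((mem_integers_iff_absv _).1 d.2)

/-- The opposite bound. Let `f = X² - TX + N` have roots `ϖ` and `τϖ`. The product is the value at
`ϖ` of `f` with `σ` applied to its coefficients; subtracting `f(ϖ) = 0` leaves `(σN - N) - (σT -
T)ϖ`. -/
theorem IsInvolutionPair.mul_le_absv_sub {σ τ : Gal(L/K)} (h : IsInvolutionPair σ τ) {ε : ℝ}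
    (hε : ∀ z, τ z = z → absv L z ≤ 1 → absv L (σ z - z) ≤ ε) :
    absv L (unif L - σ (unif L)) * absv L (unif L - σ (τ (unif L))) ≤ ε := by
  have hϖ : absv L (unif L) ≤ 1 := (rho_lt_one L).le
  have hτϖ : absv L (τ (unif L)) ≤ 1 := by rwa [absv_algEquiv]
  have hT := hε (unif L + τ (unif L)) (by rw [map_add, h.right, add_comm])
    ((absv_add_le _ _).trans (max_le hϖ hτϖ))
  have hN := hε (unif L * τ (unif L)) (by rw [map_mul, h.right, mul_comm])
    (by rw [map_mul]; exact mul_le_one₀ hϖ ((absv L).nonneg _) hτϖ)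
  have : (unif L - σ (unif L)) * (unif L - σ (τ (unif L))) =
      (σ (unif L * τ (unif L)) - unif L * τ (unif L)) -
        (σ (unif L + τ (unif L)) - (unif L + τ (unif L))) * unif L := by
    rw [map_mul, map_add]
    ring
  rw [← map_mul, this]
  refine (TwoAdic.absv_sub_le _ _).trans (max_le hN ?_)
  rw [map_mul]
  exact (mul_le_of_le_one_right ((absv L).nonneg _) hϖ).trans hT

/-- The relation between the ramification filtrations of `L / K` and of its subextension
`K(√a) / K`, where `√a` is fixed by `τ` and moved by `σ`. -/
theorem IsInvolutionPair.mul_sq_eq {σ τ : Gal(L/K)} (h : IsInvolutionPair σ τ)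
    (htot : rho K = rho L ^ Module.finrank K L) (hτϖ : τ (unif L) ≠ unif L) {a : Kˣ}
    (ha : (a : SquareClass K) ∉ classFiltration K 0) {y : L} (hy : y ^ 2 = algebraMap K L a)
    (hσ : σ y = -y) (hτ : τ y = y) :
    (absv L (unif L - σ (unif L)) * absv L (unif L - σ (τ (unif L)))) ^ 2 =
      rho K ^ discExp K (a : SquareClass K) := by
  have hy0 : y ≠ 0 := by
    rintro rfl
    rw [zero_pow two_ne_zero, eq_comm, map_eq_zero] at hy
    exact a.ne_zero hy
  obtain ⟨c, r, hr, hu, hd⟩ := exists_quadratic_uniformizer ha hy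
  rw [← hd]
  congr 1
  refine le_antisymm (h.mul_le_absv_sub fun z hz hz1 ↦ h.absv_sub_le hσ hτ hy0 hr hu hz hz1) ?_
  have hu1 : absv L ((y - algebraMap K L c) / algebraMap K L r) ≤ 1 :=
    (pow_le_one_iff_of_nonneg ((absv L).nonneg _) two_ne_zero).1 (hu.trans_le (rho_lt_one K).le)
  have hle := absv_apply_sub_le_mul (σ := σ) htot hτϖ hu1
    (by rw [map_div₀, map_sub, hτ, τ.commutes, τ.commutes])
  have hsub : σ ((y - algebraMap K L c) / algebraMap K L r) -
      (y - algebraMap K L c) / algebraMap K L r = -(2 * y / algebraMap K L r) := by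
    rw [map_div₀, map_sub, hσ, σ.commutes, σ.commutes]
    ring
  rwa [hsub, (absv L).map_neg] at hle

theorem exists_residue_of_totallyRamified (htot : rho K = rho L ^ Module.finrank K L) {z : L}
    (hz : absv L z ≤ 1) : ∃ c : K, absv L (z - algebraMap K L c) < 1 := by
  obtain ⟨c, hc, rfl⟩ := exists_coeff_of_mem_integers htot hz
  refine ⟨c ⟨0, Module.finrank_pos⟩, ?_⟩
  rw [← Finset.add_sum_erase _ _ (Finset.mem_univ ⟨0, Module.finrank_pos⟩), pow_zero, mul_one,
    add_sub_cancel_left]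
  refine Finset.sum_induction _ (fun z ↦ absv L z < 1)
    (fun x y hx hy ↦ (absv_add_le x y).trans_lt (max_lt hx hy)) (by simp) fun j hj ↦ ?_
  have hj0 : (j : ℕ) ≠ 0 := fun h ↦ (Finset.mem_erase.1 hj).1 (Fin.ext h)
  rw [map_mul, absv_algebraMap, map_pow, absv_unif]
  exact mul_lt_one_of_nonneg_of_lt_one_right (hc j) (pow_nonneg (rho_pos L).le _)
    (pow_lt_one₀ (rho_pos L).le (rho_lt_one L) hj0)

/-- For an unramified class, `θ = (√a / s - 1) / 2` is integral with conjugate `-1 - θ`. Total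
ramification gives `θ ≡ c` with `c` in `K`; conjugating and adding yields `-1 ≡ 2c ≡ 0` in the
residue field. -/
theorem notMem_classFiltration_zero_of_totallyRamified
    (htot : rho K = rho L ^ Module.finrank K L) {a : Kˣ} {y : L}
    (hy : y ^ 2 = algebraMap K L a) {σ : Gal(L/K)} (hσ : σ y = -y) :
    (a : SquareClass K) ∉ classFiltration K 0 := by
  intro ha
  rw [mk_mem_classFiltration, Nat.sub_zero, mem_sup_squares] at ha
  obtain ⟨s, -, hs⟩ := ha
  have h20 : (2 : L) ≠ 0 := two_ne_zero'
  set θ : L := (y / algebraMap K L s - 1) / 2 with hθ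
  have hθ2 : 4 * (θ * (θ + 1)) = algebraMap K L (((a / s ^ 2 : Kˣ) : K) - 1) := by
    have : (y / algebraMap K L s) ^ 2 = algebraMap K L ((a / s ^ 2 : Kˣ) : K) := by
      rw [div_pow, hy, Units.val_div_eq_div_val, Units.val_pow_eq_pow_val, map_div₀, map_pow]
    rw [map_sub, map_one, ← this, hθ]
    field_simp
    ring
  have hprod : absv L (θ * (θ + 1)) ≤ 1 := by
    have h := congrArg (absv L) hθ2
    have h4 : absv L 4 = absv K 4 := by rw [← absv_algebraMap (F := K) (L := L), map_ofNat (algebraMap K L)]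
    rw [map_mul, absv_algebraMap, h4, absv_four] at h
    rw [← h] at hs
    exact le_of_mul_le_mul_left (by rwa [mul_one]) (pow_pos (rho_pos K) _)
  have hθ1 : absv L θ ≤ 1 := by
    by_contra! hlt
    have h1 : absv L (θ + 1) = absv L θ := by
      rw [add_comm]
      exact absv_add_of_lt (by rwa [map_one])
    rw [map_mul, h1] at hprod
    nlinarith
  obtain ⟨c, hc⟩ := exists_residue_of_totallyRamified htot hθ1
  have hc' := absv_algEquiv σ (θ - algebraMap K L c)
  have hσθ : σ (θ - algebraMap K L c) = -1 - θ - algebraMap K L c := by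
    rw [map_sub, hθ, map_div₀, map_sub, map_div₀, hσ, σ.commutes, σ.commutes, map_one, map_ofNat]
    field_simp
    ring
  rw [hσθ] at hc'
  have hsum := absv_add_le (θ - algebraMap K L c) (-1 - θ - algebraMap K L c)
  rw [hc', max_self] at hsum
  have hc1 : absv L (algebraMap K L c) ≤ 1 := by
    have := TwoAdic.absv_sub_le θ (θ - algebraMap K L c)
    rw [sub_sub_cancel] at this
    exact this.trans (max_le hθ1 hc.le)
  have h2c : absv L (2 * algebraMap K L c) < absv L (-1) := by
    rw [(absv L).map_neg, map_one, map_mul]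
    exact mul_lt_one_of_nonneg_of_lt_one_left ((absv L).nonneg _) absv_two_lt hc1
  rw [show θ - algebraMap K L c + (-1 - θ - algebraMap K L c) = -(2 * algebraMap K L c) + -1 by
    ring, absv_add_of_lt (by rwa [(absv L).map_neg]), (absv L).map_neg, map_one] at hsum
  exact absurd hc (not_lt.2 hsum)

end QuadraticSubfields

theorem exists_ne_one_ne {G : Type*} [Group G] [IsKleinFour G] (s : G) :
    ∃ t : G, t ≠ 1 ∧ t ≠ s := by
  classical
  by_contra! hall
  have hsub : (Set.univ : Set G) ⊆ {1, s} := fun t _ ↦ by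
    by_cases h1 : t = 1
    · exact Or.inl h1
    · exact Or.inr (hall t h1)
  have hcard := (Set.ncard_le_ncard hsub).trans (Set.ncard_insert_le 1 {s})
  rw [Set.ncard_univ, IsKleinFour.card_four, Set.ncard_singleton] at hcard
  omega

/-! ### The discriminant of a totally ramified `V₄`-extension, and the criterion for total
ramification. -/

section KleinFour

variable {K L : Type*} [Field K] [Algebra ℚ_[2] K] [FiniteDimensional ℚ_[2] K]
    [Algebra ℤ_[2] K] [IsScalarTower ℤ_[2] ℚ_[2] K]
    [Field L] [Algebra ℚ_[2] L] [FiniteDimensional ℚ_[2] L]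
    [Algebra ℤ_[2] L] [IsScalarTower ℤ_[2] ℚ_[2] L]
    [Algebra K L] [IsScalarTower ℤ_[2] K L] [IsScalarTower ℚ_[2] K L]
    [FiniteDimensional K L]

theorem isInvolutionPair_of_isKleinFour [IsGalois K L] [IsKleinFour Gal(L/K)] {σ τ : Gal(L/K)}
    (hσ : σ ≠ 1) (hτ : τ ≠ 1) (hne : σ ≠ τ) : IsInvolutionPair σ τ := by
  classical
  refine ⟨fun z ↦ ?_, fun z ↦ ?_, fun z ↦ ?_, fun z hz hz' ↦ ?_⟩
  · rw [← AlgEquiv.mul_apply, IsKleinFour.mul_self, AlgEquiv.one_apply]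
  · rw [← AlgEquiv.mul_apply, IsKleinFour.mul_self, AlgEquiv.one_apply]
  · rw [← AlgEquiv.mul_apply, ← AlgEquiv.mul_apply,
      mul_comm_of_exponent_two IsKleinFour.exponent_two]
  · refine mem_range_of_forall_fixed fun ρ ↦ ?_
    have hρ : ρ ∈ (Finset.univ : Finset Gal(L/K)) := Finset.mem_univ _
    rw [← IsKleinFour.eq_finset_univ hσ hτ hne] at hρ
    simp only [Finset.mem_insert, Finset.mem_singleton] at hρ
    rcases hρ with rfl | rfl | rfl | rfl
    · rw [AlgEquiv.mul_apply, hz, hz']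
    · exact hz'
    · exact hz
    · rfl

theorem apply_unif_ne (htot : rho K = rho L ^ Module.finrank K L) {σ : Gal(L/K)} (hσ : σ ≠ 1) :
    σ (unif L) ≠ unif L := by
  intro h
  refine hσ (AlgEquiv.ext fun z ↦ ?_)
  have : (σ : L →ₐ[K] L) = AlgHom.id K L := (unifPowerBasis htot).algHom_ext h
  exact congrArg (fun f : L →ₐ[K] L ↦ f z) this

/-- The conductor-discriminant formula for totally ramified biquadratic extensions. -/
theorem IsBiquadratic.discrVal_eq [IsGalois K L] [CharZero K] {x y : L} (h : IsBiquadratic K x y)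
    (htot : rho K = rho L ^ Module.finrank K L) {a b : Kˣ} (hx : x ^ 2 = algebraMap K L a)
    (hy : y ^ 2 = algebraMap K L b) :
    discrVal K L = discExp K (a : SquareClass K) + discExp K (b : SquareClass K) +
      discExp K ((a * b : Kˣ) : SquareClass K) := by
  classical
  have := h.isKleinFour
  obtain ⟨s, t, ⟨hsx, hsy⟩, ⟨htx, hty⟩, -, hs1, ht1, hst⟩ := h.exists_generators
  have hst1 : s * t ≠ 1 := fun h1 ↦ hst (mul_right_cancel
    (h1.trans (IsKleinFour.mul_self t).symm))
  have hsst : s ≠ s * t := fun h1 ↦ ht1 (by simpa using h1)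
  have hxy : (x * y) ^ 2 = algebraMap K L (a * b : Kˣ) := by
    rw [mul_pow, hx, hy, Units.val_mul, map_mul]
  have hmul : ∀ z, s ((s * t) z) = t z := fun z ↦ by
    rw [← AlgEquiv.mul_apply, ← mul_assoc, IsKleinFour.mul_self, one_mul]
  have hcomm : ∀ z, t (s z) = (s * t) z := fun z ↦ by
    rw [← AlgEquiv.mul_apply, mul_comm_of_exponent_two IsKleinFour.exponent_two]
  have h1 := (isInvolutionPair_of_isKleinFour ht1 hs1 hst.symm).mul_sq_eq htot
    (apply_unif_ne htot hs1) (notMem_classFiltration_zero_of_totallyRamified htot hx htx)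
    hx htx hsx
  have h2 := (isInvolutionPair_of_isKleinFour hs1 ht1 hst).mul_sq_eq htot
    (apply_unif_ne htot ht1) (notMem_classFiltration_zero_of_totallyRamified htot hy hsy)
    hy hsy hty
  have hsxy : s (x * y) = -(x * y) := by rw [map_mul, hsx, hsy, mul_neg]
  have h3 := (isInvolutionPair_of_isKleinFour hs1 hst1 hsst).mul_sq_eq htot
    (apply_unif_ne htot hst1) (notMem_classFiltration_zero_of_totallyRamified htot hxy hsxy)
    hxy hsxy (by rw [AlgEquiv.mul_apply, map_mul t, htx, hty, map_mul, map_neg, hsx, hsy,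
      neg_mul_neg])
  rw [hmul] at h3
  rw [hcomm] at h1
  refine discrVal_eq_of_absv htot ?_
  have huniv : Finset.univ.erase (1 : Gal(L/K)) = {s * t, s, t} := by
    rw [← IsKleinFour.eq_finset_univ hs1 ht1 hst]
    ext ρ
    simp only [Finset.mem_erase, Finset.mem_insert, Finset.mem_singleton]
    constructor
    · tauto
    · rintro (rfl | rfl | rfl) <;> tauto
  have ht' : s * t ≠ t := fun h1 ↦ hs1 (by simpa using h1)
  -- Each quadratic subfield accounts for the square of a product of two of the three displacements
  -- of the uniformizer. Multiplying the three relations gives every displacement to the fourth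
  -- power, which matches `[L : K] = 4`.
  rw [absv_discr, huniv, Finset.prod_insert (by simp [hsst.symm, ht']),
    Finset.prod_insert (by simp [hst]), Finset.prod_singleton, h.finrank_eq_four, pow_add, pow_add,
    ← h1, ← h2, ← h3, AlgEquiv.mul_apply]
  ring

variable (K) in
/-- The residue class of `z` belongs to the residue field of `K`. -/
def HasResidue (z : L) : Prop := ∃ c : K, absv L (z - algebraMap K L c) < 1

/-- The residue field of `K` is perfect of characteristic two: if `z² ≡ m²`, then `(z - m)² ≡ 0`. -/
theorem HasResidue.of_sq {z : L} (hz : absv L z ≤ 1) (h : HasResidue K (z ^ 2)) :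
    HasResidue K z := by
  obtain ⟨c, hc⟩ := h
  have hz2 : absv L (z ^ 2) ≤ 1 := by rw [map_pow]; exact pow_le_one₀ ((absv L).nonneg _) hz
  have hc1 : absv K c ≤ 1 := by
    rw [← absv_algebraMap (F := K) (L := L), ← sub_sub_cancel (z ^ 2) (algebraMap K L c)]
    exact (absv_sub_le _ _).trans (max_le hz2 hc.le)
  obtain ⟨m, hm⟩ := exists_sq_residue (K := K) ⟨c, (mem_integers_iff_absv _).2 hc1⟩
  rw [← absv_algebraMap (F := K) (L := L), map_sub (algebraMap K L), map_pow] at hm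
  have hm1 : absv L (algebraMap K L m) ≤ 1 := by
    rw [absv_algebraMap]
    exact (mem_integers_iff_absv _).1 m.2
  refine ⟨m, (pow_lt_one_iff_of_nonneg ((absv L).nonneg _) two_ne_zero).1 ?_⟩
  have hzm : absv L (z - algebraMap K L m) ≤ 1 := (absv_sub_le _ _).trans (max_le hz hm1)
  have : (z - algebraMap K L m) ^ 2 = (z ^ 2 - algebraMap K L c) +
      ((algebraMap K L c - algebraMap K L m ^ 2) -
        2 * (algebraMap K L m * (z - algebraMap K L m))) := by
    ring
  rw [← map_pow, this]
  refine (absv_add_le _ _).trans_lt (max_lt hc ((absv_sub_le _ _).trans_lt (max_lt hm ?_)))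
  rw [map_mul]
  refine mul_lt_one_of_nonneg_of_lt_one_left ((absv L).nonneg _) absv_two_lt ?_
  rw [map_mul]
  exact mul_le_one₀ hm1 ((absv L).nonneg _) hzm

/-- A quadratic subextension with a larger residue field is generated by the square root of an
unramified square class. -/
theorem IsInvolutionPair.exists_sqrt {σ τ : Gal(L/K)} (h : IsInvolutionPair σ τ) {w : L}
    (hw : absv L w ≤ 1) (hτ : τ w = w) (hres : ¬ HasResidue K w) :
    ∃ (a : Kˣ) (δ : L), δ ^ 2 = algebraMap K L a ∧
      (a : SquareClass K) ∈ classFiltration K 0 ∧ δ ∉ (algebraMap K L).range := by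
  obtain ⟨T, hT⟩ := h.mem_range (w + σ w) (by rw [map_add, ← h.comm, hτ])
    (by rw [map_add, h.left, add_comm])
  obtain ⟨N, hN⟩ := h.mem_range (w * σ w) (by rw [map_mul, ← h.comm, hτ])
    (by rw [map_mul, h.left, mul_comm])
  have hσw : absv L (σ w) ≤ 1 := by rwa [absv_algEquiv]
  have hT1 : absv K T ≤ 1 := by
    rw [← absv_algebraMap (F := K) (L := L), hT]
    exact (absv_add_le _ _).trans (max_le hw hσw)
  have hN1 : absv K N ≤ 1 := by
    rw [← absv_algebraMap (F := K) (L := L), hN, map_mul]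
    exact mul_le_one₀ hw ((absv L).nonneg _) hσw
  -- If the trace were not a unit, then `w² ≡ -N`, and `w` would have its residue in that of `K`.
  have hT' : absv K T = 1 := by
    refine hT1.antisymm (le_of_not_gt fun hlt ↦ hres (.of_sq hw ⟨-N, ?_⟩))
    rw [map_neg, hN, show w ^ 2 - -(w * σ w) = (w + σ w) * w by ring, ← hT, map_mul,
      absv_algebraMap]
    exact mul_lt_one_of_nonneg_of_lt_one_left ((absv K).nonneg _) hlt hw
  have hT0 : T ≠ 0 := by
    rintro rfl
    simp at hT'
  have hTL : algebraMap K L T ≠ 0 := (map_ne_zero _).2 hT0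
  have hsmall : absv K (1 - 4 * N / T ^ 2 - 1) ≤ rho K ^ (2 * absRamificationIdx K) := by
    rw [sub_sub_cancel_left, (absv K).map_neg, map_div₀, map_mul, map_pow, hT', one_pow, div_one,
      absv_four]
    exact mul_le_of_le_one_right (pow_pos (rho_pos K) _).le hN1
  have hlt : absv K (1 - 4 * N / T ^ 2 - 1) < 1 := hsmall.trans_lt
    (pow_lt_one₀ (rho_pos K).le (rho_lt_one K) (by have := absRamificationIdx_pos K; omega))
  have ha1 : absv K (1 - 4 * N / T ^ 2) = 1 := by
    have := absv_add_of_lt (x := 1 - 4 * N / T ^ 2 - 1) (y := 1) (by rwa [map_one])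
    rwa [sub_add_cancel, map_one] at this
  have ha0 : 1 - 4 * N / T ^ 2 ≠ 0 := by
    intro h0
    rw [h0, map_zero] at ha1
    exact zero_ne_one ha1
  -- The class is that of the discriminant `T² - 4N` of `w`, normalized by `T²` so as to be
  -- congruent to `1` modulo `4`.
  refine ⟨Units.mk0 _ ha0, (w - σ w) / algebraMap K L T, ?_, ?_, ?_⟩
  · rw [Units.val_mk0, map_sub, map_one, map_div₀, map_mul, map_pow, map_ofNat, div_pow, hN,
      eq_sub_iff_add_eq, ← add_div, div_eq_one_iff_eq (pow_ne_zero _ hTL), hT]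
    ring
  · rw [mk_mem_classFiltration]
    exact Subgroup.mem_sup_left (mem_higherUnits.2 ⟨ha1, hsmall⟩)
  · intro hmem
    have hfix := apply_eq_of_mem_range hmem σ
    rw [map_div₀, map_sub, h.left, σ.commutes, div_left_inj' hTL, ← sub_eq_zero,
      show σ w - w - (w - σ w) = -(2 * (w - σ w)) by ring, neg_eq_zero, mul_eq_zero,
      or_iff_right two_ne_zero', sub_eq_zero] at hfix
    obtain ⟨c, rfl⟩ := h.mem_range w hτ hfix.symm
    exact hres ⟨c, by simp⟩

theorem absv_quadratic_lt {σ : Gal(L/K)} {z : L} (hz : absv L z ≤ 1) {a n : K}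
    (ha : absv L (z + σ z - algebraMap K L a) < 1) (hn : absv L (z * σ z - algebraMap K L n) < 1) :
    absv L (z ^ 2 - algebraMap K L a * z + algebraMap K L n) < 1 := by
  rw [show z ^ 2 - algebraMap K L a * z + algebraMap K L n =
    z * (z + σ z - algebraMap K L a) - (z * σ z - algebraMap K L n) by ring]
  refine (absv_sub_le _ _).trans_lt (max_lt ?_ hn)
  rw [map_mul]
  exact mul_lt_one_of_nonneg_of_lt_one_right hz ((absv L).nonneg _) ha

/-- Two monic quadratic relations modulo the maximal ideal with different linear coefficients would
subtract to a linear one, determining the residue of `z` in that of `K`. -/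
theorem absv_sub_lt_of_not_hasResidue {z : L} (hres : ¬ HasResidue K z)
    {a a' n n' : K} (h : absv L (z ^ 2 - algebraMap K L a * z + algebraMap K L n) < 1)
    (h' : absv L (z ^ 2 - algebraMap K L a' * z + algebraMap K L n') < 1) :
    absv K (a - a') < 1 := by
  by_contra! hge
  have h0 : a - a' ≠ 0 := by
    intro h0
    rw [h0, map_zero] at hge
    exact not_le.2 one_pos hge
  have h0' : algebraMap K L (a - a') ≠ 0 := (map_ne_zero _).2 h0
  refine hres ⟨(n - n') / (a - a'), ?_⟩
  have : z - algebraMap K L ((n - n') / (a - a')) =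
      ((z ^ 2 - algebraMap K L a' * z + algebraMap K L n') -
        (z ^ 2 - algebraMap K L a * z + algebraMap K L n)) / algebraMap K L (a - a') := by
    rw [map_div₀, eq_div_iff h0', sub_mul, div_mul_cancel₀ _ h0', map_sub, map_sub]
    ring
  rw [this, map_div₀, absv_algebraMap]
  exact (div_le_self ((absv L).nonneg _) hge).trans_lt
    ((absv_sub_le _ _).trans_lt (max_lt h' h))

/-- Passes from `L` to a quadratic subfield. Suppose `z + τz ≡ a(τ)` and `z τz ≡ n(τ)` for all `τ ≠
1`. Uniqueness of the quadratic relation gives `a(s) ≡ a(t)`; applying `s` to the relation for `t`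
gives `stz ≡ z`, so `a(st) ≡ 2z ≡ 0`. Then `z² ≡ -n(st)`, contradicting `HasResidue.of_sq`. -/
theorem exists_not_hasResidue_of_fixed [IsGalois K L] [IsKleinFour Gal(L/K)] {z : L}
    (hz : absv L z ≤ 1) (hres : ¬ HasResidue K z) :
    ∃ τ : Gal(L/K), τ ≠ 1 ∧ (¬ HasResidue K (z + τ z) ∨ ¬ HasResidue K (z * τ z)) := by
  classical
  by_contra! hc
  obtain ⟨s, hs⟩ : ∃ s : Gal(L/K), s ≠ 1 := (exists_ne_one_ne 1).imp fun _ h ↦ h.1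
  obtain ⟨t, ht, hts⟩ : ∃ t : Gal(L/K), t ≠ 1 ∧ t ≠ s := exists_ne_one_ne s
  have hst : s * t ≠ 1 := fun h1 ↦ hts (mul_right_cancel
    (h1.trans (IsKleinFour.mul_self t).symm)).symm
  choose! hadd hmul using hc
  choose! a ha using hadd
  choose! n hn using hmul
  have hq : ∀ τ, τ ≠ 1 → absv L (z ^ 2 - algebraMap K L (a τ) * z + algebraMap K L (n τ)) < 1 :=
    fun τ hτ ↦ absv_quadratic_lt hz (ha τ hτ) (hn τ hτ)
  have hsub := absv_sub_lt_of_not_hasResidue hres (hq s hs) (hq t ht)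
  have h1 : absv L (s (z + t z - algebraMap K L (a t))) < 1 := by
    rw [absv_algEquiv]
    exact ha t ht
  have h2 : absv L (2 * z) < 1 := by
    rw [map_mul]
    exact mul_lt_one_of_nonneg_of_lt_one_left ((absv L).nonneg _) absv_two_lt hz
  have key : absv L (algebraMap K L (a (s * t))) < 1 := by
    have : algebraMap K L (a (s * t)) = (2 * z - algebraMap K L (a s - a t)) +
        ((s (z + t z - algebraMap K L (a t)) - (z + s z - algebraMap K L (a s))) -
          (z + (s * t) z - algebraMap K L (a (s * t)))) := by
      rw [map_sub s, map_add s, s.commutes, AlgEquiv.mul_apply, map_sub]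
      ring
    rw [this]
    refine (absv_add_le _ _).trans_lt (max_lt ((absv_sub_le _ _).trans_lt (max_lt h2 ?_))
      ((absv_sub_le _ _).trans_lt (max_lt ((absv_sub_le _ _).trans_lt (max_lt h1 (ha s hs)))
        (ha _ hst))))
    rwa [absv_algebraMap]
  refine hres (.of_sq hz ⟨-n (s * t), ?_⟩)
  rw [map_neg, sub_neg_eq_add, show z ^ 2 + algebraMap K L (n (s * t)) =
    (z ^ 2 - algebraMap K L (a (s * t)) * z + algebraMap K L (n (s * t))) +
      algebraMap K L (a (s * t)) * z by ring]
  refine (absv_add_le _ _).trans_lt (max_lt (hq _ hst) ?_)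
  rw [map_mul]
  exact mul_lt_one_of_nonneg_of_lt_one_left ((absv L).nonneg _) key hz

/-- A `V₄`-extension that is not totally ramified contains the square root of an unramified square
class. -/
theorem exists_sqrt_of_not_isTotallyRamified [IsGalois K L] [IsKleinFour Gal(L/K)]
    (htot : ¬ IsTotallyRamified K L) : ∃ (a : Kˣ) (δ : L), δ ^ 2 = algebraMap K L a ∧
      (a : SquareClass K) ∈ classFiltration K 0 ∧ δ ∉ (algebraMap K L).range := by
  classical
  obtain ⟨z, hz, hres⟩ : ∃ z : L, absv L z ≤ 1 ∧ ¬ HasResidue K z := by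
    by_contra! hc
    exact htot (isTotallyRamified_of_residue hc)
  obtain ⟨τ, hτ, hw⟩ := exists_not_hasResidue_of_fixed hz hres
  obtain ⟨σ, hσ, hστ⟩ : ∃ σ : Gal(L/K), σ ≠ 1 ∧ σ ≠ τ := exists_ne_one_ne τ
  have h := isInvolutionPair_of_isKleinFour hσ hτ hστ
  have hτz : absv L (τ z) ≤ 1 := by rwa [absv_algEquiv]
  rcases hw with hw | hw
  · exact h.exists_sqrt ((absv_add_le _ _).trans (max_le hz hτz))
      (by rw [map_add, h.right, add_comm]) hw
  · exact h.exists_sqrt (by rw [map_mul]; exact mul_le_one₀ hz ((absv L).nonneg _) hτz)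
      (by rw [map_mul, h.right, mul_comm]) hw

end KleinFour

section ExponentTwo

variable {G : Type*} [CommGroup G]

theorem ne_mul_right_of_ne_one {v w : G} (h : w ≠ 1) : v ≠ v * w :=
  fun h1 ↦ h (left_eq_mul.1 h1)

theorem ne_mul_left_of_ne_one {v w : G} (h : v ≠ 1) : w ≠ v * w :=
  fun h1 ↦ h (right_eq_mul.1 h1)

theorem mul_eq_of_mul_self (h : ∀ v : G, v * v = 1) {v w v' w' : G}
    (hv : v' = v ∨ v' = w ∨ v' = v * w) (hw : w' = v ∨ w' = w ∨ w' = v * w) (hne : v' ≠ w') :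
    v' * w' = v ∨ v' * w' = w ∨ v' * w' = v * w := by
  have h1 : v * (v * w) = w := by rw [← mul_assoc, h, one_mul]
  have h2 : w * (v * w) = v := by rw [mul_left_comm, h, mul_one]
  rcases hv with hv | hv | hv <;> rcases hw with hw | hw | hw <;>
    first
    | exact absurd (hv.trans hw.symm) hne
    | simp [hv, hw, h1, h2, mul_comm w v, mul_comm (v * w)]

end ExponentTwo

/-! ### Counting generating pairs and assembling the mass. -/

section Mass

variable {K : Type*} [Field K] [Algebra ℚ_[2] K] [FiniteDimensional ℚ_[2] K]
    [Algebra ℤ_[2] K] [IsScalarTower ℤ_[2] ℚ_[2] K]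

instance finiteDimensional_padic_biquad (v w : SquareClass K) :
    FiniteDimensional ℚ_[2] (biquad v w) :=
  FiniteDimensional.trans ℚ_[2] K (biquad v w)

/-- The pair `(v, w)` generates a totally ramified `V₄`-extension. -/
def IsRamifiedPair (p : SquareClass K × SquareClass K) : Prop :=
  p.1 ∉ classFiltration K 0 ∧ p.2 ∉ classFiltration K 0 ∧ p.1 * p.2 ∉ classFiltration K 0

namespace IsRamifiedPair

variable {v w : SquareClass K} (h : IsRamifiedPair (v, w))

include h

theorem left_ne_one : v ≠ 1 := fun h1 ↦ h.1 (h1 ▸ one_mem _)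

theorem right_ne_one : w ≠ 1 := fun h1 ↦ h.2.1 (h1 ▸ one_mem _)

theorem mul_ne_one : v * w ≠ 1 := fun h1 ↦ h.2.2 (h1 ▸ one_mem _)

theorem ne : v ≠ w := fun h1 ↦ h.mul_ne_one (h1 ▸ mul_self_squareClass v)

/-- Otherwise the field contains an unramified square root outside `K`, whose class must be `v`, `w`
or `vw`. -/
theorem isTotallyRamified : IsTotallyRamified K (biquad v w) := by
  have := charZero_of_algebra_padic K
  have := isGalois_biquad v w
  have hb := isBiquadratic_biquad h.left_ne_one h.right_ne_one h.mul_ne_one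
  have := hb.isKleinFour
  by_contra htot
  obtain ⟨a, δ, hδ, ha, hδ'⟩ := exists_sqrt_of_not_isTotallyRamified htot
  have hmem : sqrtClass (a : SquareClass K) ∈ biquad v w :=
    sqrtClass_mem δ.2 (congrArg Subtype.val hδ)
  rcases mem_of_sqrtClass_mem_biquad h.left_ne_one h.right_ne_one h.mul_ne_one hmem with
    h1 | h1 | h1 | h1
  · obtain ⟨c, hc⟩ := exists_sq_mul_of_mk_eq_mk (b := 1) h1
    rw [mul_one] at hc
    rw [hc, Units.val_pow_eq_pow_val, map_pow] at hδ
    rcases sq_eq_sq_iff_eq_or_eq_neg.1 hδ with h2 | h2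
    · exact hδ' ⟨c, h2.symm⟩
    · exact hδ' ⟨-c, by rw [h2, map_neg]⟩
  · exact h.1 (h1 ▸ ha)
  · exact h.2.1 (h1 ▸ ha)
  · exact h.2.2 (h1 ▸ ha)

theorem discrVal_eq : discrVal K (biquad v w) = discExp K v + discExp K w + discExp K (v * w) := by
  have := charZero_of_algebra_padic K
  have := isGalois_biquad v w
  have hb := isBiquadratic_biquad h.left_ne_one h.right_ne_one h.mul_ne_one
  rw [hb.discrVal_eq (isTotallyRamified_iff.1 h.isTotallyRamified)
    (Subtype.ext (sqrtClass_sq v)) (Subtype.ext (sqrtClass_sq w)), QuotientGroup.mk_mul, out_eq,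
    out_eq]

theorem massTerm_eq : massTerm K (Quotient.mk (extSetoid K) (biquad v w)) =
    4⁻¹ * (weight K v * weight K w * weight K (v * w)) := by
  have := charZero_of_algebra_padic K
  have := isGalois_biquad v w
  have hb := isBiquadratic_biquad h.left_ne_one h.right_ne_one h.mul_ne_one
  have := hb.isKleinFour
  change (Nat.card Gal(biquad v w/K) : ℝ)⁻¹ / (residueCard K : ℝ) ^ discrVal K (biquad v w) = _
  rw [IsKleinFour.card_four, h.discrVal_eq, weight_of_notMem h.1, weight_of_notMem h.2.1,
    weight_of_notMem h.2.2, ← pow_add, ← pow_add, inv_pow, div_eq_mul_inv]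
  norm_cast

theorem mk_mem_totRamQuartics :
    (Quotient.mk (extSetoid K) (biquad v w) : ExtClass K) ∈ totRamQuartics K V4 :=
  have := charZero_of_algebra_padic K
  ⟨biquad v w, rfl, finrank_biquad h.left_ne_one h.right_ne_one h.mul_ne_one, h.isTotallyRamified,
    hasGaloisClosureGroup_biquad h.left_ne_one h.right_ne_one h.mul_ne_one⟩

end IsRamifiedPair

theorem isRamifiedPair_of_isTotallyRamified {v w : SquareClass K} (hv : v ≠ 1) (hw : w ≠ 1)
    (hvw : v * w ≠ 1) (htot : IsTotallyRamified K (biquad v w)) : IsRamifiedPair (v, w) := by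
  have := charZero_of_algebra_padic K
  have := isGalois_biquad v w
  have hb := isBiquadratic_biquad hv hw hvw
  rw [isTotallyRamified_iff] at htot
  have key : ∀ (z : biquad v w) (a : Kˣ), z ∉ (algebraMap K (biquad v w)).range →
      z ^ 2 = algebraMap K (biquad v w) a → (a : SquareClass K) ∉ classFiltration K 0 := by
    intro z a hz hza
    obtain ⟨σ, hσ⟩ := exists_apply_eq_neg ⟨_, hza.symm⟩ hz
    exact notMem_classFiltration_zero_of_totallyRamified htot hza hσ
  have hxv : (⟨sqrtClass v, left_mem_biquad v w⟩ : biquad v w) ^ 2 =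
      algebraMap K (biquad v w) (Quotient.out v : Kˣ) := Subtype.ext (sqrtClass_sq v)
  have hxw : (⟨sqrtClass w, right_mem_biquad v w⟩ : biquad v w) ^ 2 =
      algebraMap K (biquad v w) (Quotient.out w : Kˣ) := Subtype.ext (sqrtClass_sq w)
  refine ⟨?_, ?_, ?_⟩
  · simpa only [out_eq] using key _ _ hb.left_notMem hxv
  · simpa only [out_eq] using key _ _ hb.right_notMem hxw
  · simpa only [QuotientGroup.mk_mul, out_eq] using key _ (Quotient.out v * Quotient.out w)
      hb.mul_notMem (by rw [mul_pow, hxv, hxw, Units.val_mul, map_mul])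

theorem totRamQuartics_V4_eq : totRamQuartics K V4 =
    (fun p : SquareClass K × SquareClass K ↦ Quotient.mk (extSetoid K) (biquad p.1 p.2)) ''
      {p | IsRamifiedPair p} := by
  have := charZero_of_algebra_padic K
  refine Set.Subset.antisymm ?_ ?_
  · rintro _ ⟨L, rfl, hL, htot, hG⟩
    obtain ⟨v, w, hv, hw, hvw, rfl⟩ := exists_eq_biquad hL hG
    exact ⟨(v, w), isRamifiedPair_of_isTotallyRamified hv hw hvw htot, rfl⟩
  · rintro _ ⟨⟨v, w⟩, h, rfl⟩
    exact h.mk_mem_totRamQuartics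

theorem sqrtClass_mem_of_algEquiv {L M : IntermediateField K (AlgebraicClosure K)}
    (f : L ≃ₐ[K] M) {v : SquareClass K} (hv : sqrtClass v ∈ L) : sqrtClass v ∈ M := by
  refine mem_of_sq_eq (f ⟨sqrtClass v, hv⟩).2 ?_
  rw [sqrtClass_sq, ← SubmonoidClass.coe_pow, ← map_pow,
    show (⟨sqrtClass v, hv⟩ : L) ^ 2 = algebraMap K L (Quotient.out v : Kˣ) from
      Subtype.ext (sqrtClass_sq v), f.commutes]
  rfl

/-- Any two distinct nontrivial elements generate a Klein four-group, so each field arises from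
exactly six ordered pairs. -/
theorem mk_biquad_eq_iff [DecidableEq (SquareClass K)] {v w v' w' : SquareClass K}
    (h : IsRamifiedPair (v, w)) :
    IsRamifiedPair (v', w') ∧
      Quotient.mk (extSetoid K) (biquad v' w') = Quotient.mk (extSetoid K) (biquad v w) ↔
    (v', w') ∈ ({v, w, v * w} : Finset (SquareClass K)).offDiag := by
  have := charZero_of_algebra_padic K
  have hmem : ∀ u ∈ ({v, w, v * w} : Finset (SquareClass K)),
      u ∉ classFiltration K 0 ∧ sqrtClass u ∈ biquad v w := by
    intro u hu
    simp only [Finset.mem_insert, Finset.mem_singleton] at hu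
    rcases hu with rfl | rfl | rfl
    · exact ⟨h.1, left_mem_biquad _ _⟩
    · exact ⟨h.2.1, right_mem_biquad _ _⟩
    · exact ⟨h.2.2, sqrtClass_mul_mem (left_mem_biquad _ _) (right_mem_biquad _ _)⟩
  rw [Finset.mem_offDiag]
  constructor
  · rintro ⟨h', heq⟩
    obtain ⟨f⟩ := Quotient.exact heq
    have key : ∀ u : SquareClass K, u ≠ 1 → sqrtClass u ∈ biquad v' w' →
        u ∈ ({v, w, v * w} : Finset (SquareClass K)) := by
      intro u hu1 hu
      simp only [Finset.mem_insert, Finset.mem_singleton]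
      exact (mem_of_sqrtClass_mem_biquad h.left_ne_one h.right_ne_one h.mul_ne_one
        (sqrtClass_mem_of_algEquiv f hu)).resolve_left hu1
    exact ⟨key _ h'.left_ne_one (left_mem_biquad _ _), key _ h'.right_ne_one (right_mem_biquad _ _),
      h'.ne⟩
  · rintro ⟨hv', hw', hne⟩
    have hvw' : v' * w' ∉ classFiltration K 0 := by
      have hcases : v' * w' = v ∨ v' * w' = w ∨ v' * w' = v * w := by
        simp only [Finset.mem_insert, Finset.mem_singleton] at hv' hw'
        exact mul_eq_of_mul_self mul_self_squareClass hv' hw' hne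
      rcases hcases with h1 | h1 | h1 <;> rw [h1]
      · exact h.1
      · exact h.2.1
      · exact h.2.2
    have h' : IsRamifiedPair (v', w') := ⟨(hmem _ hv').1, (hmem _ hw').1, hvw'⟩
    exact ⟨h', congrArg _ (biquad_eq_of_mem h.left_ne_one h.right_ne_one h.mul_ne_one
      h'.left_ne_one h'.right_ne_one h'.mul_ne_one (hmem _ hv').2 (hmem _ hw').2)⟩

theorem finite_totRamQuartics_V4 : (totRamQuartics K V4).Finite := by
  rw [totRamQuartics_V4_eq]
  exact (Set.toFinite _).image _

-- The constant is `24 = 4 · 6`: four automorphisms, six ordered pairs of generators.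
open Classical in
theorem mass_totRamQuartics_V4 :
    mass K (totRamQuartics K V4) = 24⁻¹ * pairSumOn (weight K) ⊤ := by
  set Φ : SquareClass K × SquareClass K → ExtClass K :=
    fun p ↦ Quotient.mk (extSetoid K) (biquad p.1 p.2) with hΦ
  set P : Finset (SquareClass K × SquareClass K) := Finset.univ.filter IsRamifiedPair with hP
  have hcoe : totRamQuartics K V4 = ((P.image Φ : Finset (ExtClass K)) : Set (ExtClass K)) := by
    rw [totRamQuartics_V4_eq, Finset.coe_image]
    simp only [hP, Finset.coe_filter, Finset.mem_univ, true_and]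
    rfl
  have hfib : ∀ c ∈ P.image Φ, (P.filter fun p ↦ Φ p = c).card = 6 := by
    intro c hc
    obtain ⟨⟨v, w⟩, hp, rfl⟩ := Finset.mem_image.1 hc
    have h : IsRamifiedPair (v, w) := (Finset.mem_filter.1 hp).2
    have : P.filter (fun p ↦ Φ p = Φ (v, w)) =
        ({v, w, v * w} : Finset (SquareClass K)).offDiag := by
      ext ⟨v', w'⟩
      rw [← mk_biquad_eq_iff h, Finset.mem_filter, hP, Finset.mem_filter]
      simp only [Finset.mem_univ, true_and]
      rfl
    rw [this, Finset.offDiag_card, Finset.card_eq_three.2 ⟨v, w, v * w, h.ne,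
      ne_mul_right_of_ne_one h.right_ne_one,
      ne_mul_left_of_ne_one h.left_ne_one, rfl⟩]
  have hsum : ∑ p ∈ P, massTerm K (Φ p) = 6 * mass K (totRamQuartics K V4) := by
    rw [mass, hcoe, Finset.tsum_subtype' (P.image Φ) (massTerm K), Finset.sum_comp, Finset.mul_sum]
    refine Finset.sum_congr rfl fun c hc ↦ ?_
    rw [hfib c hc, nsmul_eq_mul]
    norm_cast
  have hpair : ∑ p ∈ P, massTerm K (Φ p) = 4⁻¹ * pairSumOn (weight K) ⊤ := by
    have h1 : pairSumOn (weight K) ⊤ = ∑ p : SquareClass K × SquareClass K,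
        weight K p.1 * weight K p.2 * weight K (p.1 * p.2) := by
      rw [pairSumOn, Fintype.sum_prod_type]
      simp
    -- The weight vanishes on the trivial and the unramified class, so degenerate pairs and pairs
    -- whose field is not totally ramified drop out.
    have h2 : ∑ p ∈ P, weight K p.1 * weight K p.2 * weight K (p.1 * p.2) =
        ∑ p : SquareClass K × SquareClass K, weight K p.1 * weight K p.2 * weight K (p.1 * p.2) :=
      Finset.sum_filter_of_ne fun p _ hp ↦
        ⟨fun h ↦ hp (by rw [weight_of_mem h, zero_mul, zero_mul]),
          fun h ↦ hp (by rw [weight_of_mem h, mul_zero, zero_mul]),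
          fun h ↦ hp (by rw [weight_of_mem h, mul_zero])⟩
    rw [h1, ← h2, Finset.mul_sum]
    exact Finset.sum_congr rfl fun p hp ↦ IsRamifiedPair.massTerm_eq (Finset.mem_filter.1 hp).2
  linarith

end Mass

end TwoAdic

end

theorem mainTheorem10 (K : Type*) [Field K] [Algebra ℚ_[2] K] [FiniteDimensional ℚ_[2] K]
    [Algebra ℤ_[2] K] [IsScalarTower ℤ_[2] ℚ_[2] K]
    (q : ℝ) (hq : q = TwoAdic.residueCard K)
    (e : ℤ) (he : e = TwoAdic.absRamificationIdx K) :
    (TwoAdic.totRamQuartics K TwoAdic.V4).Finite ∧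
    TwoAdic.mass K (TwoAdic.totRamQuartics K TwoAdic.V4) =
      (q - 1) / 6 *
        (q ^ (-4 * e - 3) * ((q ^ (4 * e) - 1) / (q ^ 4 - 1)) * (3 * q ^ 3 + q ^ 2 + q + 3) -
          3 * q ^ (-3 * e - 3) * ((q ^ (3 * e) - 1) / (q ^ 3 - 1)) * (q ^ 2 + 1)) := by
  refine ⟨TwoAdic.finite_totRamQuartics_V4, ?_⟩
  rw [TwoAdic.mass_totRamQuartics_V4, TwoAdic.pairSumOn_weight_top hq he,
    inv_mul_cancel_left₀ (by norm_num)]
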